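/- Let $G$ be a finite multigraph in which every edge has multiplicity at least $2$ (the multiplicity of an edge is the number of edges with the same ends, itself included), and let $\mathcal F$ be a nonempty family of simple subgraphs of $G$, each with at least one edge. Let $\mathrm{KG}(G,\mathcal F)$ be the graph whose vertices are the edge sets of those subgraphs of $G$ that are isomorphic to a member of $\mathcal F$, two of them being adjacent when they are disjoint, and let $\mathrm{ex}(G,\mathcal F)$ be the maximum number of edges of a spanning subgraph of $G$ that has no subgraph isomorphic to a member of $\mathcal F$. For a finite hypergraph $\mathcal H$ (a finite vertex set $V(\mathcal H)$ with a set of nonempty subsets of it, the hyperedges), let $\mathrm{KG}(\mathcal H)$ be the graph whose vertices are the hyperedges of $\mathcal H$, two being adjacent when they are disjoint. For $X\in\{-1,0,1\}^n\setminus\{0\}$ let $\mathrm{alt}(X)$ be the length of a longest subsequence of nonzero terms of $X$ in which any two consecutive terms are distinct. For a linear ordering $\sigma: v_1<\dots<v_n$ of $V(\mathcal H)$ put $X^{\pm}_\sigma=\{v_j : x_j=\pm1\}$. Let $\mathrm{alt}_\sigma(\mathcal H)$ (respectively $\mathrm{salt}_\sigma(\mathcal H)$) be the largest value of $\mathrm{alt}(X)$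 over all $X\in\{-1,0,1\}^n\setminus\{0\}$ such that none (respectively at most one) of $X^+_\sigma$ and $X^-_\sigma$ contains a hyperedge of $\mathcal H$, and $0$ if there is no such $X$; let $\mathrm{alt}(\mathcal H)$ and $\mathrm{salt}(\mathcal H)$ be the minima of these numbers over all linear orderings $\sigma$ of $V(\mathcal H)$. The altermatic and strong altermatic numbers of a finite graph $\Gamma$ are $$\zeta(\Gamma)=\max_{\mathcal H}\bigl(|V(\mathcal H)|-\mathrm{alt}(\mathcal H)\bigr),\qquad \zeta_s(\Gamma)=\max_{\mathcal H}\bigl(|V(\mathcal H)|+1-\mathrm{salt}(\mathcal H)\bigr),$$ where $\mathcal H$ ranges over all finite hypergraphs with $\mathrm{KG}(\mathcal H)\cong\Gamma$. Then $$\chi(\mathrm{KG}(G,\mathcal F))=\zeta(\mathrm{KG}(G,\mathcal F))=|E(G)|-\mathrm{ex}(G,\mathcal F).$$ If moreover every edge of $G$ has even multiplicity, then $$\chi(\mathrm{KG}(G,\mathcal F))=\zeta_s(\mathrm{KG}(G,\mathcal F)).$$ -/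

import Mathlib

/-! Finite multigraphs are Mathlib's `Graph α β` (vertices in `α`, edges in `β`), and hypergraphs
without repeated hyperedges are Mathlib's `Hypergraph α`. -/

namespace KneserMultigraph

section Hypergraphs

/-- The Kneser graph `KG(H)`: its vertices are the hyperedges of `H`, and two of them are adjacent
when they are disjoint. -/
def kneserGraph {γ : Type*} (H : Hypergraph γ) : SimpleGraph H.edgeSet where
  Adj A B := A ≠ B ∧ Disjoint (A : Set γ) (B : Set γ)
  symm := ⟨fun _ _ h => ⟨h.1.symm, h.2.symm⟩⟩
  loopless := ⟨fun _ h => h.1 rfl⟩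

/-- `H` is a finite hypergraph all of whose hyperedges are nonempty. -/
def IsFiniteHypergraph {γ : Type*} (H : Hypergraph γ) : Prop :=
  H.vertexSet.Finite ∧ ∀ e ∈ H.edgeSet, e.Nonempty

/-- `alt(X)`: the length of a longest alternating subsequence of nonzero terms of the sign
vector `X`. -/
noncomputable def altLength {n : ℕ} (X : Fin n → SignType) : ℕ :=
  sSup {m : ℕ | ∃ j : Fin m → Fin n, StrictMono j ∧ (∀ i, X (j i) ≠ 0) ∧
    ∀ i k : Fin m, (i : ℕ) + 1 = k → X (j i) ≠ X (j k)}

/-- For a linear ordering `σ` (listing the elements of `V` as `σ 0, σ 1, …`), the set of those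
elements of `V` at whose position the vector `X` has the sign `s`. For `s = 1` and `s = -1` these
are the sets `X⁺_σ` and `X⁻_σ`. -/
def signPart {γ : Type*} {V : Set γ} {n : ℕ} (σ : Fin n ≃ V) (X : Fin n → SignType)
    (s : SignType) : Set γ :=
  {v | ∃ j, X j = s ∧ (σ j : γ) = v}

/-- The set `A` of vertices contains some hyperedge of `H`. -/
def ContainsHyperedge {γ : Type*} (H : Hypergraph γ) (A : Set γ) : Prop :=
  ∃ e ∈ H.edgeSet, e ⊆ A

/-- A linear ordering of the vertices of a finite hypergraph. -/
abbrev VertexOrdering {γ : Type*} (H : Hypergraph γ) : Type _ :=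
  Fin H.vertexSet.ncard ≃ H.vertexSet

/-- `alt_σ(H)`: the largest `alt(X)` over the nonzero sign vectors `X` such that neither `X⁺_σ` nor
`X⁻_σ` contains a hyperedge, and `0` if there is no such `X`. -/
noncomputable def altOrd {γ : Type*} (H : Hypergraph γ) (σ : VertexOrdering H) : ℕ :=
  sSup {k : ℕ | ∃ X : Fin H.vertexSet.ncard → SignType, X ≠ 0 ∧ altLength X = k ∧
    ¬ ContainsHyperedge H (signPart σ X 1) ∧ ¬ ContainsHyperedge H (signPart σ X (-1))}

/-- `salt_σ(H)`: the largest `alt(X)` over the nonzero sign vectors `X` such that at most one of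
`X⁺_σ` and `X⁻_σ` contains a hyperedge. -/
noncomputable def saltOrd {γ : Type*} (H : Hypergraph γ) (σ : VertexOrdering H) : ℕ :=
  sSup {k : ℕ | ∃ X : Fin H.vertexSet.ncard → SignType, X ≠ 0 ∧ altLength X = k ∧
    ¬ (ContainsHyperedge H (signPart σ X 1) ∧ ContainsHyperedge H (signPart σ X (-1)))}

/-- `alt(H)`: the minimum of `alt_σ(H)` over all linear orderings of the vertices. -/
noncomputable def alt {γ : Type*} (H : Hypergraph γ) : ℕ :=
  ⨅ σ : VertexOrdering H, altOrd H σ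

/-- `salt(H)`: the minimum of `salt_σ(H)` over all linear orderings of the vertices. -/
noncomputable def salt {γ : Type*} (H : Hypergraph γ) : ℕ :=
  ⨅ σ : VertexOrdering H, saltOrd H σ

/-- The altermatic number `ζ(G)`: the maximum of `|V(H)| - alt(H)` over the finite hypergraphs `H`
with `KG(H) ≅ G`. Every finite hypergraph is isomorphic to one with vertices in `ℕ`, and
`alt(H) ≤ |V(H)|`, so the subtraction does not truncate. The supremum is taken in `ℕ∞`, where it
exists without any boundedness condition; when it is finite and some such `H` exists, it is a
maximum. -/
noncomputable def altermaticNumber {W : Type*} (G : SimpleGraph W) : ℕ∞ :=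
  ⨆ (H : Hypergraph ℕ) (_ : IsFiniteHypergraph H) (_ : Nonempty (kneserGraph H ≃g G)),
    ((H.vertexSet.ncard - alt H : ℕ) : ℕ∞)

/-- The strong altermatic number `ζ_s(G)`: the maximum of `|V(H)| + 1 - salt(H)` over the finite
hypergraphs `H` with `KG(H) ≅ G`. -/
noncomputable def strongAltermaticNumber {W : Type*} (G : SimpleGraph W) : ℕ∞ :=
  ⨆ (H : Hypergraph ℕ) (_ : IsFiniteHypergraph H) (_ : Nonempty (kneserGraph H ≃g G)),
    ((H.vertexSet.ncard + 1 - salt H : ℕ) : ℕ∞)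

end Hypergraphs

section Multigraphs

/-- Isomorphism of multigraphs: bijections between the vertex sets and between the edge sets that
preserve incidence. -/
def IsIsomorphic {α β α' β' : Type*} (K : Graph α β) (L : Graph α' β') : Prop :=
  ∃ (φ : K.vertexSet ≃ L.vertexSet) (ψ : K.edgeSet ≃ L.edgeSet),
    ∀ (e : K.edgeSet) (x y : K.vertexSet),
      K.IsLink (e : β) (x : α) (y : α) ↔ L.IsLink (ψ e : β') (φ x : α') (φ y : α')

/-- The multiplicity of an edge `e` of `G`: the number of edges with the same ends as `e`,
including `e` itself. -/
noncomputable def edgeMultiplicity {α β : Type*} (G : Graph α β) (e : β) : ℕ :=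
  {f | f ∈ G.edgeSet ∧ ∀ x y, G.IsLink f x y ↔ G.IsLink e x y}.ncard

/-- `G` is `𝓕`-free: no subgraph of `G` is isomorphic to a member of `𝓕`. -/
def IsFree {α β α' β' : Type*} (G : Graph α β) (𝓕 : Set (Graph α' β')) : Prop :=
  ∀ L ≤ G, ∀ K ∈ 𝓕, ¬ IsIsomorphic L K

/-- The generalized Turán number `ex(G, 𝓕)`: the maximum number of edges of an `𝓕`-free spanning
subgraph of `G`. -/
noncomputable def ex {α β α' β' : Type*} (G : Graph α β) (𝓕 : Set (Graph α' β')) : ℕ :=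
  sSup {k : ℕ | ∃ H : Graph α β, H.IsSpanningSubgraph G ∧ IsFree H 𝓕 ∧ H.edgeSet.ncard = k}

/-- The hypergraph whose vertices are the edges of `G`, and whose hyperedges are the edge sets of
the subgraphs of `G` that are isomorphic to a member of `𝓕`. -/
def copyHypergraph {α β α' β' : Type*} (G : Graph α β) (𝓕 : Set (Graph α' β')) :
    Hypergraph β where
  vertexSet := G.edgeSet
  edgeSet := {A | ∃ L ≤ G, (∃ K ∈ 𝓕, IsIsomorphic L K) ∧ L.edgeSet = A}
  subset_vertexSet_of_mem_edgeSet' := by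
    rintro _ ⟨L, hL, -, rfl⟩
    exact Graph.IsSubgraph.edgeSet_mono hL

/-- The Kneser graph `KG(G, 𝓕)`. -/
abbrev KG {α β α' β' : Type*} (G : Graph α β) (𝓕 : Set (Graph α' β')) :
    SimpleGraph (copyHypergraph G 𝓕).edgeSet :=
  kneserGraph (copyHypergraph G 𝓕)

end Multigraphs

end KneserMultigraph

/-! All inequalities come from one squeeze. Upper bound: take an extremal $\mathcal F$-free spanning
subgraph $H$; every copy uses an edge outside $H$, and choosing one such edge as its colour is a
proper colouring with $|E(G)|-\mathrm{ex}$ colours (`colorable_KG`).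

Topological lower bound: $\zeta$, and $\zeta_s$ when there is a hyperedge, are at most $\chi$. Given
a colouring and an ordering, a sign vector is labelled by its alternation length if its parts
contain too few hyperedges, and otherwise by the largest colour found in the two parts. The
octahedral Tucker lemma bounds the dimension by the number of labels (`add_le_of_colour`). Tucker's
lemma itself is proved by Ky Fan's parity count, with chains mod 2 on the sphere of sign vectors
(`octahedral_tucker`).

Combinatorial lower bound: list the edges with parallel classes as consecutive blocks. Since members
of $\mathcal F$ are simple, adding all parallels of its edges to a copy-free set creates no copy
(`not_containsHyperedge_parallelClosure`), so the enlarged set has at most $\mathrm{ex}$ edges. If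
both parts of $X$ are copy-free, counting block by block, with blocks of size at least 2, shows that
$2\,\mathrm{alt}(X)$ is at most the total size of the two enlarged parts, hence
$\mathrm{alt}\le\mathrm{ex}$. If only one part is copy-free, blocks of even size still give
$\mathrm{alt}(X)\le\mathrm{ex}+1$, hence $\mathrm{salt}\le\mathrm{ex}+1$. -/

namespace KneserMultigraph

/-! ### Ky Fan's parity argument and the octahedral Tucker lemma. -/

section Tucker

/-- The transpose of the mod 2 simplicial boundary: the sum of `f` over the lists obtained from `l`
by deleting one entry. -/
def bdry {V : Type*} : (List V → ZMod 2) → List V → ZMod 2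
  | _, [] => 0
  | f, x :: l => f l + bdry (fun t => f (x :: t)) l

theorem bdry_add {V : Type*} (f g : List V → ZMod 2) (l : List V) :
    bdry (fun t => f t + g t) l = bdry f l + bdry g l := by
  induction l generalizing f g with
  | nil => simp [bdry]
  | cons x l ih => simp only [bdry, ih]; ring

theorem bdry_map {V W : Type*} (s : V → W) (f : List W → ZMod 2) (l : List V) :
    bdry (fun t => f (t.map s)) l = bdry f (l.map s) := by
  induction l generalizing f with
  | nil => simp [bdry]
  | cons x l ih => simp only [bdry, List.map_cons, ← ih]

theorem bdry_congr {V : Type*} {f g : List V → ZMod 2} {l : List V}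
    (h : ∀ t, t.Sublist l → f t = g t) : bdry f l = bdry g l := by
  induction l generalizing f g with
  | nil => rfl
  | cons x l ih =>
    simp only [bdry]
    rw [h l (List.sublist_cons_self x l), ih fun t ht => h _ (ht.cons_cons x)]

theorem bdry_perm {V : Type*} {f : List V → ZMod 2} (hf : ∀ s t : List V, s.Perm t → f s = f t)
    {l l' : List V} (h : l.Perm l') : bdry f l = bdry f l' := by
  induction h generalizing f with
  | nil => rfl
  | cons x h ih =>
    simp only [bdry]
    rw [hf _ _ h, ih fun s t hst => hf _ _ (hst.cons x)]
  | swap x y l =>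
    simp only [bdry]
    rw [bdry_congr (g := fun t => f (y :: x :: t)) fun t _ => hf _ _ (.swap _ _ t)]
    ring
  | trans _ _ ih₁ ih₂ => exact (ih₁ hf).trans (ih₂ hf)

/-- The transpose of the part of the prism operator that keeps the first entry in the bottom. -/
def prismTail {V : Type*} (s : V → V) : (List V → ZMod 2) → List V → ZMod 2
  | _, [] => 0
  | f, x :: l => prismTail s (fun t => f (x :: t)) l + f (x :: s x :: l.map s)

/-- The transpose of the prism operator from the bottom to the top `s`, with cone point `e`. -/
def prism {V : Type*} (s : V → V) (e : V) (f : List V → ZMod 2) (l : List V) : ZMod 2 :=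
  f (e :: l.map s) + prismTail s f l

theorem prismTail_add {V : Type*} (s : V → V) (f g : List V → ZMod 2) (l : List V) :
    prismTail s (fun t => f t + g t) l = prismTail s f l + prismTail s g l := by
  induction l generalizing f g with
  | nil => simp [prismTail]
  | cons x l ih => simp only [prismTail, ih]; ring

theorem prismTail_bdry {V : Type*} (s : V → V) (f : List V → ZMod 2) (l : List V) :
    prismTail s (bdry f) l = f (l.map s) + f l + bdry (prismTail s f) l := by
  induction l generalizing f with
  | nil => simp [prismTail, bdry, CharTwo.add_self_eq_zero]
  | cons x l ih =>
    simp only [prismTail, bdry, prismTail_add, ih, List.map_cons, bdry_add]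
    rw [bdry_map s (fun t => f (x :: s x :: t)) l]
    linear_combination CharTwo.add_self_eq_zero (f (x :: l.map s))

/-- The chain homotopy identity: the prism joins the identity to `s`, and the cone with apex `e`
fills in the top, so only the bottom and the prism over the boundary remain. -/
theorem prism_bdry {V : Type*} (s : V → V) (e : V) (f : List V → ZMod 2) (l : List V) :
    prism s e (bdry f) l = f l + bdry (prism s e f) l := by
  unfold prism
  rw [prismTail_bdry, bdry_add, bdry_map s (fun t => f (e :: t)) l]
  simp only [bdry]
  linear_combination CharTwo.add_self_eq_zero (f (l.map s))

/-- Alternating sign lists whose first sign (if any) is `b`, as a mod 2 indicator. -/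
def alternating : Bool → List Bool → ZMod 2
  | _, [] => 1
  | b, x :: l => if x = b then alternating (!b) l else 0

/-- Fan's count for a nonempty list: deleting the last entry of a list alternating from `b`, or the
first entry of one alternating from `!b`, is the only good deletion; any other list has zero or two,
the two being the members of an adjacent equal pair. -/
theorem bdry_alternating (b : Bool) (l : List Bool) :
    bdry (alternating b) l = alternating b l + alternating (!b) l := by
  induction l generalizing b with
  | nil => simp [bdry, alternating, CharTwo.add_self_eq_zero]
  | cons x l ih =>
    have hz : ∀ l : List Bool, bdry (fun _ => 0) l = 0 := by
      intro l
      induction l with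
      | nil => rfl
      | cons x l ih => simp [bdry, ih]
    by_cases h : x = b
    · subst h
      simp only [bdry, alternating, if_true, ih, Bool.not_not]
      simp
      linear_combination CharTwo.add_self_eq_zero (alternating x l)
    · have h' : x = !b := by cases x <;> cases b <;> simp_all
      subst h'
      simp [bdry, alternating, hz]

theorem alternating_map_not (b : Bool) (l : List Bool) :
    alternating b (l.map not) = alternating (!b) l := by
  induction l generalizing b with
  | nil => rfl
  | cons x l ih => cases x <;> cases b <;> simp [alternating, ih]

/-- Labels `±i` are pairs of an absolute value and a sign, ordered lexicographically. -/
abbrev Label := ℕ ×ₗ Bool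

/-- The label of opposite sign. -/
def Label.neg (x : Label) : Label := toLex ((ofLex x).1, !(ofLex x).2)

/-- The indicator of lists of labels which, sorted by absolute value, alternate in sign,
starting with the sign `b`. -/
noncomputable def labelAlternating (b : Bool) (L : List Label) : ZMod 2 :=
  alternating b (((L : Multiset Label).sort (· ≤ ·)).map fun x => (ofLex x).2)

/-- Both sides are invariant under permutation, so the list may be taken sorted; its sublists are
then sorted too and the identity reduces to signs. -/
theorem bdry_labelAlternating (b : Bool) (L : List Label) :
    bdry (labelAlternating b) L = labelAlternating b L + labelAlternating (!b) L := by
  have hp : ((L : Multiset Label).sort (· ≤ ·)).Perm L := by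
    rw [← Multiset.coe_eq_coe, Multiset.sort_eq]
  have hperm : ∀ s t : List Label, s.Perm t → labelAlternating b s = labelAlternating b t := by
    intro s t h
    simp only [labelAlternating, Multiset.coe_eq_coe.2 h]
  rw [← bdry_perm hperm hp]
  rw [bdry_congr (g := fun t => alternating b (t.map fun x => (ofLex x).2))]
  · rw [bdry_map, bdry_alternating]
    rfl
  · intro t ht
    have hs : t.Pairwise (· ≤ ·) := (Multiset.pairwise_sort _ _).sublist ht
    have : ((t : Multiset Label).sort (· ≤ ·)) = t := by
      refine List.Perm.eq_of_pairwise (le := (· ≤ ·)) ?_ (Multiset.pairwise_sort _ _) hs ?_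
      · intro a b _ _ h h'
        exact le_antisymm h h'
      · rw [← Multiset.coe_eq_coe, Multiset.sort_eq]
    simp only [labelAlternating, this]

/-- Lists of labels without two labels of the same absolute value and opposite signs. -/
def NoComplementary (L : List Label) : Prop :=
  ∀ x ∈ L, ∀ y ∈ L, (ofLex x).1 = (ofLex y).1 → x = y

/-- Without complementary pairs, ties in absolute value are ties of labels, so negation does not
disturb the sorted order. -/
theorem labelAlternating_map_neg {L : List Label} (hL : NoComplementary L) (b : Bool) :
    labelAlternating b (L.map Label.neg) = labelAlternating (!b) L := by
  have hp : ((L : Multiset Label).sort (· ≤ ·)).Perm L := by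
    rw [← Multiset.coe_eq_coe, Multiset.sort_eq]
  have : (((L.map Label.neg : List Label) : Multiset Label).sort (· ≤ ·)) =
      ((L : Multiset Label).sort (· ≤ ·)).map Label.neg := by
    refine List.Perm.eq_of_pairwise (le := (· ≤ ·)) ?_ (Multiset.pairwise_sort _ _) ?_ ?_
    · intro a b _ _ h h'
      exact le_antisymm h h'
    · rw [List.pairwise_map]
      refine (Multiset.pairwise_sort (L : Multiset Label) (· ≤ ·)).imp_of_mem ?_
      intro x y hx hy hxy
      by_cases h : (ofLex x).1 = (ofLex y).1
      · rw [hL x (hp.subset hx) y (hp.subset hy) h]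
      · rw [Prod.Lex.le_iff] at hxy ⊢
        left
        rcases hxy with h' | h'
        · exact h'
        · exact absurd h'.1 h
    · refine List.Perm.trans ?_ (hp.symm.map _)
      rw [← Multiset.coe_eq_coe, Multiset.sort_eq]
  unfold labelAlternating
  rw [this, ← alternating_map_not]
  simp [List.map_map, Function.comp_def, Label.neg]

/-- Neighbours of equal absolute value would be equal labels, contradicting the alternation of
signs. -/
theorem chain_of_alternating {b : Bool} {L : List Label} (hs : L.Pairwise (· ≤ ·))
    (hL : NoComplementary L) (h : alternating b (L.map fun x => (ofLex x).2) ≠ 0) :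
    (L.map fun x => (ofLex x).1).Pairwise (· < ·) := by
  induction L generalizing b with
  | nil => simp
  | cons x L ih =>
    have hx : (ofLex x).2 = b ∧ alternating (!b) (L.map fun x => (ofLex x).2) ≠ 0 := by
      simp only [List.map_cons, alternating] at h
      split_ifs at h with h'
      · exact ⟨h', h⟩
      · exact absurd rfl h
    have hL' : NoComplementary L := fun y hy z hz =>
      hL y (List.mem_cons_of_mem _ hy) z (List.mem_cons_of_mem _ hz)
    have ih' := ih (List.Pairwise.of_cons hs) hL' hx.2
    cases L with
    | nil => simp
    | cons y L =>
      have hy : (ofLex y).2 = !b := by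
        have := hx.2
        simp only [List.map_cons, alternating] at this
        split_ifs at this with h'
        · exact h'
        · exact absurd rfl this
      have hxy : x ≤ y := (List.pairwise_cons.1 hs).1 y (by simp)
      have hlt : (ofLex x).1 < (ofLex y).1 := by
        rw [Prod.Lex.le_iff] at hxy
        rcases hxy with h' | h'
        · exact h'
        · have := hL x (by simp) y (by simp) h'.1
          rw [← this, hx.1] at hy
          cases b <;> simp at hy
      rw [List.map_cons, List.pairwise_cons]
      refine ⟨?_, ih'⟩
      intro z hz
      rw [List.map_cons, List.mem_cons] at hz
      rcases hz with rfl | hz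
      · exact hlt
      · rw [List.map_cons, List.pairwise_cons] at ih'
        exact hlt.trans (ih'.1 z hz)

variable {n : ℕ}

/-- The order of sign vectors: `Y` agrees with `X` wherever `X` is nonzero. -/
def SignLE (X Y : Fin n → SignType) : Prop := ∀ i, X i ≠ 0 → Y i = X i

/-- Chains of `k` nonzero sign vectors supported in the first `k` coordinates. -/
def IsSignChain (k : ℕ) (l : List (Fin n → SignType)) : Prop :=
  l.length = k ∧ l.Pairwise SignLE ∧ ∀ X ∈ l, X ≠ 0 ∧ ∀ i : Fin n, k ≤ i → X i = 0

/-- The transpose of the fundamental chain of the subdivided boundary of the cross-polytope spanned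
by the first `k` coordinates. -/
def sphere : (k : ℕ) → k ≤ n → (List (Fin n → SignType) → ZMod 2) → ZMod 2
  | 0, _, f => f []
  | k + 1, h, f =>
    let s : (Fin n → SignType) → Fin n → SignType := fun X => Function.update X ⟨k, h⟩ 1
    sphere k (Nat.le_of_succ_le h) (prism s (s 0) f) +
      sphere k (Nat.le_of_succ_le h) (prism s (s 0) fun l => f (l.map fun X => -X))

theorem sphere_add {k : ℕ} (h : k ≤ n) (f g : List (Fin n → SignType) → ZMod 2) :
    sphere k h (fun l => f l + g l) = sphere k h f + sphere k h g := by
  induction k generalizing f g with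
  | zero => rfl
  | succ k ih =>
    have : ∀ (s : (Fin n → SignType) → Fin n → SignType) e (f g : List (Fin n → SignType) → ZMod 2),
        prism s e (fun l => f l + g l) = fun l => prism s e f l + prism s e g l := by
      intro s e f g
      funext l
      simp only [prism, prismTail_add]
      ring
    simp only [sphere, this, ih]
    ring

theorem sphere_neg {k : ℕ} (h : k ≤ n) (f : List (Fin n → SignType) → ZMod 2) :
    sphere k h (fun l => f (l.map fun X => -X)) = sphere k h f := by
  cases k with
  | zero => rfl
  | succ k => simp [sphere, List.map_map, add_comm]

/-- The sphere is a cycle: each hemisphere has the sphere one dimension lower as boundary, and that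
equator, being antipodally symmetric, is counted twice. -/
theorem sphere_bdry {k : ℕ} (h : k ≤ n) (f : List (Fin n → SignType) → ZMod 2) :
    sphere k h (bdry f) = 0 := by
  induction k generalizing f with
  | zero => rfl
  | succ k ih =>
    have hb : (fun l => bdry f (l.map fun X : Fin n → SignType => -X)) =
        bdry fun l => f (l.map fun X => -X) := by
      funext l
      rw [bdry_map]
    have hp : ∀ s e (f : List (Fin n → SignType) → ZMod 2),
        prism s e (bdry f) = fun l => f l + bdry (prism s e f) l := by
      intro s e f
      funext l
      exact prism_bdry s e f l
    simp only [sphere, hb, hp, sphere_add, ih, sphere_neg]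
    simp [CharTwo.add_self_eq_zero]

theorem prismTail_congr {V : Type*} {s : V → V} {f g : List V → ZMod 2} {l : List V}
    (h : ∀ l₁ x l₂, l = l₁ ++ x :: l₂ →
      f (l₁ ++ x :: (x :: l₂).map s) = g (l₁ ++ x :: (x :: l₂).map s)) :
    prismTail s f l = prismTail s g l := by
  induction l generalizing f g with
  | nil => rfl
  | cons y l ih =>
    simp only [prismTail]
    congr 1
    · refine ih fun l₁ x l₂ hl => ?_
      exact h (y :: l₁) x l₂ (by rw [hl]; rfl)
    · exact h [] y l rfl

theorem prism_congr {k : ℕ} (h : k < n) {f g : List (Fin n → SignType) → ZMod 2}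
    (hfg : ∀ l, IsSignChain (k + 1) l → f l = g l) {l : List (Fin n → SignType)}
    (hl : IsSignChain k l) :
    prism (fun X => Function.update X ⟨k, h⟩ 1) (Function.update (0 : Fin n → SignType) ⟨k, h⟩ 1) f l =
      prism (fun X => Function.update X ⟨k, h⟩ 1) (Function.update (0 : Fin n → SignType) ⟨k, h⟩ 1) g l := by
  obtain ⟨hlen, hpw, hmem⟩ := hl
  have hmono : ∀ X Y : Fin n → SignType, SignLE X Y →
      SignLE (Function.update X ⟨k, h⟩ 1) (Function.update Y ⟨k, h⟩ 1) := by
    intro X Y hXY i hi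
    by_cases hik : i = ⟨k, h⟩
    · subst hik; simp
    · simp only [Function.update_of_ne hik] at hi ⊢
      exact hXY i hi
  have hself : ∀ X ∈ l, SignLE X (Function.update X ⟨k, h⟩ 1) := by
    intro X hX i hi
    rw [Function.update_of_ne]
    rintro rfl
    exact hi ((hmem X hX).2 _ le_rfl)
  have hne : ∀ X : Fin n → SignType, Function.update X ⟨k, h⟩ 1 ≠ 0 := by
    intro X h0
    have := congrFun h0 ⟨k, h⟩
    simp at this
  have hsupp : ∀ X : Fin n → SignType, (∀ i : Fin n, k ≤ i → X i = 0) → ∀ i : Fin n,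
      k + 1 ≤ i → Function.update X ⟨k, h⟩ 1 i = 0 := by
    intro X hX i hi
    rw [Function.update_of_ne]
    · exact hX i (by omega)
    · rintro rfl
      simp at hi
  unfold prism
  congr 1
  · refine hfg _ ⟨by simp [hlen], ?_, ?_⟩
    · rw [List.pairwise_cons]
      refine ⟨?_, List.pairwise_map.2 (hpw.imp fun {X Y} hXY => hmono X Y hXY)⟩
      intro Y hY
      obtain ⟨X, -, rfl⟩ := List.mem_map.1 hY
      exact hmono 0 X fun i hi => absurd rfl hi
    · intro Y hY
      rcases List.mem_cons.1 hY with rfl | hY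
      · exact ⟨hne 0, hsupp 0 fun _ _ => rfl⟩
      · obtain ⟨X, hX, rfl⟩ := List.mem_map.1 hY
        exact ⟨hne X, hsupp X (hmem X hX).2⟩
  -- A prism chain runs along the bottom up to `x` and continues on the top from the raised copy of
  -- `x`; it is increasing because every vector lies below its raised copy.
  · refine prismTail_congr fun l₁ x l₂ hl => hfg _ ⟨?_, ?_, ?_⟩
    · rw [hl] at hlen
      simp at hlen ⊢
      omega
    · have hl' : l = (l₁ ++ [x]) ++ l₂ := by simp [hl]
      have hsplit : l₁ ++ x :: (x :: l₂).map (fun X => Function.update X ⟨k, h⟩ 1) =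
          (l₁ ++ [x]) ++ (x :: l₂).map (fun X => Function.update X ⟨k, h⟩ 1) := by simp
      rw [hsplit, List.pairwise_append]
      refine ⟨?_, ?_, ?_⟩
      · rw [hl', List.pairwise_append] at hpw
        exact hpw.1
      · rw [hl, List.pairwise_append] at hpw
        exact List.pairwise_map.2 (hpw.2.1.imp fun {X Y} hXY => hmono X Y hXY)
      · intro a ha b hb
        obtain ⟨c, hc, rfl⟩ := List.mem_map.1 hb
        have hcl : c ∈ l := by rw [hl]; exact List.mem_append_right _ hc
        have hac : SignLE a c := by
          by_cases hacx : a = c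
          · subst hacx; exact fun _ _ => rfl
          rw [hl, List.pairwise_append] at hpw
          obtain ⟨-, h2, h3⟩ := hpw
          rcases List.mem_append.1 ha with ha | ha
          · exact h3 a ha c hc
          · rw [List.mem_singleton] at ha
            subst ha
            rcases List.mem_cons.1 hc with rfl | hc
            · exact absurd rfl hacx
            · exact (List.pairwise_cons.1 h2).1 c hc
        intro i hi
        have h1 := hac i hi
        rw [hself c hcl i (by rw [h1]; exact hi), h1]
    · intro Y hY
      have hYl : Y ∈ l ∨ ∃ X ∈ l, Function.update X ⟨k, h⟩ 1 = Y := by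
        rw [hl]
        simp only [List.mem_append, List.mem_cons, List.mem_map] at hY ⊢
        rcases hY with hY | hY | ⟨X, hX, rfl⟩
        · exact Or.inl (Or.inl hY)
        · exact Or.inl (Or.inr (Or.inl hY))
        · exact Or.inr ⟨X, Or.inr hX, rfl⟩
      rcases hYl with hY | ⟨X, hX, rfl⟩
      · exact ⟨(hmem Y hY).1, fun i hi => (hmem Y hY).2 i (by omega)⟩
      · exact ⟨hne X, hsupp X (hmem X hX).2⟩

theorem IsSignChain.neg {k : ℕ} {l : List (Fin n → SignType)} (hl : IsSignChain k l) :
    IsSignChain k (l.map fun X => -X) := by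
  obtain ⟨hlen, hpw, hmem⟩ := hl
  refine ⟨by simpa using hlen, List.pairwise_map.2 (hpw.imp fun {X Y} hXY i hi => ?_), ?_⟩
  · have hi' : X i ≠ 0 := by
      rintro h0
      exact hi (by simp [h0])
    simp [hXY i hi']
  · intro Y hY
    obtain ⟨X, hX, rfl⟩ := List.mem_map.1 hY
    refine ⟨fun h0 => (hmem X hX).1 ?_, fun i hi => by simp [(hmem X hX).2 i hi]⟩
    funext i
    have := congrFun h0 i
    revert this
    simp only [Pi.neg_apply, Pi.zero_apply]
    generalize X i = a
    revert a
    decide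

/-- The functional evaluates only on sign chains, which is what lets the labelling hypotheses, valid
only for nonzero comparable vectors, be used under it. -/
theorem sphere_congr {k : ℕ} (h : k ≤ n) {f g : List (Fin n → SignType) → ZMod 2}
    (hfg : ∀ l, IsSignChain k l → f l = g l) : sphere k h f = sphere k h g := by
  induction k generalizing f g with
  | zero => exact hfg [] ⟨rfl, List.Pairwise.nil, by simp⟩
  | succ k ih =>
    simp only [sphere]
    congr 1
    · exact ih _ fun l hl => prism_congr h hfg hl
    · exact ih _ fun l hl => prism_congr h (fun l hl => hfg _ hl.neg) hl

/-- The octahedral Tucker lemma. -/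
theorem octahedral_tucker {m : ℕ} (lab : (Fin n → SignType) → Label)
    (hneg : ∀ X, X ≠ 0 → lab (-X) = (lab X).neg)
    (hcompl : ∀ X Y, X ≠ 0 → SignLE X Y → (ofLex (lab X)).1 = (ofLex (lab Y)).1 → lab X = lab Y)
    (hlt : ∀ X, X ≠ 0 → (ofLex (lab X)).1 < m) : n ≤ m := by
  have hNC : ∀ {k l}, IsSignChain k l → NoComplementary (l.map lab) := by
    rintro k l ⟨-, hpw, hmem⟩ x hx y hy hxy
    obtain ⟨X, hX, rfl⟩ := List.mem_map.1 hx
    obtain ⟨Y, hY, rfl⟩ := List.mem_map.1 hy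
    by_contra hne
    have hXY : X ≠ Y := by rintro rfl; exact hne rfl
    have : ∀ X ∈ l, ∀ Y ∈ l, X ≠ Y → SignLE X Y ∨ SignLE Y X := by
      intro X hX Y hY hXY
      have : Std.Symm fun X Y : Fin n → SignType => SignLE X Y ∨ SignLE Y X := ⟨fun _ _ => Or.symm⟩
      exact List.Pairwise.forall (R := fun X Y => SignLE X Y ∨ SignLE Y X)
        (hpw.imp fun h => Or.inl h) hX hY hXY
    rcases this X hX Y hY hXY with h | h
    · exact hne (hcompl X Y (hmem X hX).1 h hxy)
    · exact hne (hcompl Y X (hmem Y hY).1 h hxy.symm).symm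
  let φ : List (Fin n → SignType) → ZMod 2 := fun l => labelAlternating true (l.map lab)
  -- The two hemispheres contribute `φ` plus its antipode, which equals `bdry φ` on chains by Fan's
  -- count; the homotopy identity then leaves the sphere one dimension lower plus a boundary, which
  -- vanishes on a cycle.
  have key : ∀ k (h : k ≤ n), sphere k h φ = 1 := by
    intro k
    induction k with
    | zero =>
      intro h
      simp [sphere, φ, labelAlternating, alternating]
    | succ k ih =>
      intro h
      have h1 : sphere (k + 1) h φ = sphere k (Nat.le_of_succ_le h)
          (prism (fun X => Function.update X ⟨k, h⟩ 1) (Function.update (0 : Fin n → SignType) ⟨k, h⟩ 1)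
            fun l => φ l + φ (l.map fun X => -X)) := by
        simp only [sphere]
        rw [← sphere_add]
        refine congrArg _ (funext fun l => ?_)
        simp only [prism, prismTail_add]
        ring
      rw [h1, sphere_congr (g := prism (fun X => Function.update X ⟨k, h⟩ 1)
        (Function.update (0 : Fin n → SignType) ⟨k, h⟩ 1) (bdry φ))]
      · rw [show prism (fun X => Function.update X ⟨k, h⟩ 1) (Function.update (0 : Fin n → SignType) ⟨k, h⟩ 1) (bdry φ) =
          fun l => φ l + bdry (prism _ _ φ) l from funext fun l => prism_bdry _ _ φ l]
        rw [sphere_add, sphere_bdry, ih, add_zero]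
      · intro l hl
        refine prism_congr h (fun l hl => ?_) hl
        simp only [φ]
        rw [bdry_map lab (labelAlternating true), bdry_labelAlternating,
          ← labelAlternating_map_neg (hNC hl), List.map_map, List.map_map]
        congr 2
        refine List.map_congr_left fun X hX => ?_
        exact hneg X (hl.2.2 X hX).1
  obtain ⟨l, hl, hφ⟩ : ∃ l, IsSignChain n l ∧ φ l ≠ 0 := by
    by_contra! h
    have h0 : sphere n le_rfl φ = sphere n le_rfl fun _ => 0 + 0 :=
      sphere_congr le_rfl fun l hl => by simpa using h l hl
    rw [sphere_add, CharTwo.add_self_eq_zero, key] at h0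
    exact one_ne_zero h0
  -- The alternating chain found has `n` labels, whose absolute values are distinct and below `m`.
  set L : List Label := ((l.map lab : List Label) : Multiset Label).sort (· ≤ ·) with hLdef
  have hp : L.Perm (l.map lab) := by rw [hLdef, ← Multiset.coe_eq_coe, Multiset.sort_eq]
  have hpw : (L.map fun x => (ofLex x).1).Pairwise (· < ·) := by
    refine chain_of_alternating (Multiset.pairwise_sort _ _) ?_ hφ
    intro x hx y hy
    exact hNC hl x (hp.subset hx) y (hp.subset hy)
  have hsub : (L.map fun x => (ofLex x).1).toFinset ⊆ Finset.range m := by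
    intro i hi
    rw [List.mem_toFinset, List.mem_map] at hi
    obtain ⟨x, hx, rfl⟩ := hi
    obtain ⟨X, hX, rfl⟩ := List.mem_map.1 (hp.subset hx)
    exact Finset.mem_range.2 (hlt X (hl.2.2 X hX).1)
  have hcard := Finset.card_le_card hsub
  rw [List.toFinset_card_of_nodup (hpw.imp fun h => h.ne), List.length_map, hp.length_eq,
    List.length_map, hl.1, Finset.card_range] at hcard
  exact hcard

end Tucker

/-! ### Alternating subsequences and the labelling of sign vectors. -/

section Alternation

variable {n : ℕ}

/-- The positions `j 0 < j 1 < …` carry an alternating subsequence of nonzero terms of `X`. -/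
def IsAlternating {m : ℕ} (X : Fin n → SignType) (j : Fin m → Fin n) : Prop :=
  StrictMono j ∧ (∀ i, X (j i) ≠ 0) ∧ ∀ i k : Fin m, (i : ℕ) + 1 = k → X (j i) ≠ X (j k)

theorem bddAbove_alternating (X : Fin n → SignType) :
    BddAbove {m : ℕ | ∃ j : Fin m → Fin n, IsAlternating X j} := by
  refine ⟨n, ?_⟩
  rintro m ⟨j, hj, -⟩
  simpa using Fintype.card_le_of_injective j hj.injective

theorem IsAlternating.le_altLength {m : ℕ} {X : Fin n → SignType} {j : Fin m → Fin n}
    (h : IsAlternating X j) : m ≤ altLength X :=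
  le_csSup (bddAbove_alternating X) ⟨j, h⟩

theorem exists_isAlternating (X : Fin n → SignType) :
    ∃ j : Fin (altLength X) → Fin n, IsAlternating X j :=
  Nat.sSup_mem (s := {m : ℕ | ∃ j : Fin m → Fin n, IsAlternating X j})
    ⟨0, Fin.elim0, fun i => i.elim0, fun i => i.elim0, fun i => i.elim0⟩ (bddAbove_alternating X)

theorem altLength_le (X : Fin n → SignType) : altLength X ≤ n := by
  obtain ⟨j, hj, -⟩ := exists_isAlternating X
  simpa using Fintype.card_le_of_injective j hj.injective

theorem altLength_pos {X : Fin n → SignType} (hX : X ≠ 0) : 0 < altLength X := by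
  obtain ⟨i, hi⟩ := Function.ne_iff.1 hX
  refine IsAlternating.le_altLength (m := 1) (j := fun _ => i) ⟨?_, fun _ => hi, ?_⟩
  · intro a b hab
    exact absurd (Subsingleton.elim a b) hab.ne
  · intro a b hab
    omega

theorem IsAlternating.mono {m : ℕ} {X Y : Fin n → SignType} {j : Fin m → Fin n}
    (h : IsAlternating X j) (hXY : SignLE X Y) : IsAlternating Y j := by
  refine ⟨h.1, fun i => ?_, fun i k hik => ?_⟩
  · rw [hXY _ (h.2.1 i)]
    exact h.2.1 i
  · rw [hXY _ (h.2.1 i), hXY _ (h.2.1 k)]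
    exact h.2.2 i k hik

theorem altLength_neg (X : Fin n → SignType) : altLength (-X) = altLength X := by
  have h : ∀ X : Fin n → SignType, altLength X ≤ altLength (-X) := by
    intro X
    obtain ⟨j, hj⟩ := exists_isAlternating X
    refine IsAlternating.le_altLength (j := j) ⟨hj.1, fun i => ?_, fun i k hik => ?_⟩
    · simpa using hj.2.1 i
    · simpa using hj.2.2 i k hik
  exact le_antisymm (by simpa using h (-X)) (h X)

theorem IsAlternating.cons {m : ℕ} {X : Fin n → SignType} {j : Fin (m + 1) → Fin n}
    (h : IsAlternating X j) {i₀ : Fin n} (hlt : i₀ < j 0) (hi₀ : X i₀ ≠ 0)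
    (hne : X i₀ ≠ X (j 0)) : IsAlternating X (Fin.cons i₀ j : Fin (m + 2) → Fin n) := by
  refine ⟨?_, ?_, ?_⟩
  · rw [Fin.strictMono_iff_lt_succ]
    intro i
    refine Fin.cases ?_ (fun i => ?_) i
    · simpa using hlt
    · rw [Fin.cons_succ, Fin.castSucc_succ, Fin.cons_succ]
      exact h.1 i.castSucc_lt_succ
  · intro i
    refine Fin.cases ?_ (fun i => ?_) i
    · simpa using hi₀
    · simpa using h.2.1 i
  · intro i k
    refine Fin.cases ?_ (fun k => ?_) k
    · intro hik
      simp at hik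
    · refine Fin.cases ?_ (fun i => ?_) i
      · intro hik
        have : k = 0 := by
          ext
          simpa using hik.symm
        subst this
        simpa using hne
      · intro hik
        simpa using h.2.2 i k (by simpa using hik)

/-- The first nonzero term of `X` is positive. -/
def FirstPositive (X : Fin n → SignType) : Prop := ∃ i, X i = 1 ∧ ∀ k < i, X k = 0

theorem exists_first {X : Fin n → SignType} (hX : X ≠ 0) :
    ∃ i, X i ≠ 0 ∧ ∀ k < i, X k = 0 := by
  have hne : (Finset.univ.filter fun i => X i ≠ 0).Nonempty := by
    obtain ⟨i, hi⟩ := Function.ne_iff.1 hX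
    exact ⟨i, by simpa using hi⟩
  refine ⟨Finset.min' _ hne, ?_, fun k hk => ?_⟩
  · simpa using Finset.min'_mem _ hne
  · by_contra h
    exact absurd (Finset.min'_le _ k (by simpa using h)) (not_le.2 hk)

theorem firstPositive_iff {X : Fin n → SignType} {i : Fin n} (hi : X i ≠ 0)
    (hlt : ∀ k < i, X k = 0) : FirstPositive X ↔ X i = 1 := by
  refine ⟨?_, fun h => ⟨i, h, hlt⟩⟩
  rintro ⟨k, hk, hk'⟩
  rcases lt_trichotomy i k with h | h | h
  · exact absurd (hk' i h) hi
  · rw [h, hk]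
  · rw [hlt k h] at hk
    exact absurd hk (by decide)

theorem firstPositive_neg {X : Fin n → SignType} (hX : X ≠ 0) :
    FirstPositive (-X) ↔ ¬ FirstPositive X := by
  obtain ⟨i, hi, hlt⟩ := exists_first hX
  rw [firstPositive_iff hi hlt, firstPositive_iff (i := i)]
  · rw [Pi.neg_apply]
    revert hi
    generalize X i = a
    revert a
    decide
  · simpa using hi
  · intro k hk
    simp [hlt k hk]

/-- Otherwise the first nonzero term could be put in front of a longest alternating subsequence. -/
theorem IsAlternating.apply_zero_eq {m : ℕ} {X : Fin n → SignType} {j : Fin (m + 1) → Fin n}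
    (h : IsAlternating X j) (hm : altLength X = m + 1) {i : Fin n} (hi : X i ≠ 0)
    (hlt : ∀ k < i, X k = 0) : X i = X (j 0) := by
  by_contra hne
  have hij : i < j 0 := by
    rcases lt_trichotomy i (j 0) with h' | h' | h'
    · exact h'
    · exact absurd (by rw [h']) hne
    · exact absurd (hlt _ h') (h.2.1 0)
  have := (h.cons hij hi hne).le_altLength
  omega

/-- A longest alternating subsequence of `X` is also longest for `Y`, and its first sign is the
first sign of both vectors. This excludes complementary labels among vectors labelled by
alternation. -/
theorem firstPositive_congr {X Y : Fin n → SignType} (hX : X ≠ 0) (hXY : SignLE X Y)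
    (h : altLength X = altLength Y) : FirstPositive X ↔ FirstPositive Y := by
  have hY : Y ≠ 0 := by
    rintro rfl
    obtain ⟨i, hi⟩ := Function.ne_iff.1 hX
    exact hi (hXY i hi).symm
  obtain ⟨m, hm⟩ := Nat.exists_eq_succ_of_ne_zero (altLength_pos hX).ne'
  obtain ⟨j, hj⟩ : ∃ j : Fin (m + 1) → Fin n, IsAlternating X j := by
    rw [← Nat.succ_eq_add_one, ← hm]
    exact exists_isAlternating X
  obtain ⟨x, hx, hx'⟩ := exists_first hX
  obtain ⟨y, hy, hy'⟩ := exists_first hY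
  rw [firstPositive_iff hx hx', firstPositive_iff hy hy', hj.apply_zero_eq hm hx hx',
    (hj.mono hXY).apply_zero_eq (h.symm.trans hm) hy hy', hXY _ (hj.2.1 0)]

/-- The application of the octahedral Tucker lemma to lower bounds on chromatic numbers: `p X` is
the largest colour of a hyperedge contained in the positive part of `X`. -/
theorem add_le_of_colour {b C t : ℕ} (p : (Fin n → SignType) → ℕ)
    (hmono : ∀ X Y, SignLE X Y → p X ≤ p Y) (hC : ∀ X, p X ≤ C)
    (hne : ∀ X, p X = p (-X) → p X = 0)
    (S : (Fin n → SignType) → Prop) (hS : ∀ X, S (-X) ↔ S X)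
    (hb : ∀ X, X ≠ 0 → S X → altLength X ≤ b) (ht : 1 ≤ t) (htC : t ≤ C + 1)
    (hbig : ∀ X, ¬ S X → t ≤ max (p X) (p (-X))) : n + t ≤ b + C + 1 := by
  classical
  -- On nonzero vectors, absolute values `0, …, b - 1` record alternation lengths and `b, …, b + C -
  -- t` record top colours. The ranges are disjoint and use `b + C + 1 - t` values in all.
  let lab : (Fin n → SignType) → Label := fun X =>
    if S X then toLex (altLength X - 1, decide (FirstPositive X))
    else toLex (b + max (p X) (p (-X)) - t, decide (p (-X) < p X))
  have hSLE : ∀ X Y : Fin n → SignType, SignLE X Y → SignLE (-X) (-Y) := by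
    intro X Y h i hi
    have : X i ≠ 0 := by simpa using hi
    simp [h i this]
  have hmax : ∀ X, p X ≤ C ∧ p (-X) ≤ C := fun X => ⟨hC _, hC _⟩
  suffices n ≤ b + C + 1 - t by omega
  refine octahedral_tucker lab ?_ ?_ ?_
  · intro X hX
    by_cases hs : S X
    · have hs' : S (-X) := (hS X).2 hs
      simp [lab, hs, hs', Label.neg, altLength_neg, firstPositive_neg hX]
    · have hs' : ¬ S (-X) := fun h => hs ((hS X).1 h)
      simp only [lab, hs, hs', Label.neg, if_false, neg_neg, max_comm (p (-X)), ofLex_toLex,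
        ← decide_not]
      congr 2
      have h1 := hbig X hs
      have h2 := hne X
      simp only [decide_eq_decide, not_lt]
      constructor
      · exact fun h => h.le
      · intro h
        rcases h.lt_or_eq with h | h
        · exact h
        · have := h2 h
          rw [← h, this] at h1
          simp at h1
          omega
  · intro X Y hX hXY hlab
    have hmaxle : max (p X) (p (-X)) ≤ max (p Y) (p (-Y)) :=
      max_le_max (hmono _ _ hXY) (hmono _ _ (hSLE _ _ hXY))
    have hY : Y ≠ 0 := by
      rintro rfl
      obtain ⟨i, hi⟩ := Function.ne_iff.1 hX
      exact hi (hXY i hi).symm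
    have hXpos := altLength_pos hX
    have hYpos := altLength_pos hY
    by_cases hsX : S X <;> by_cases hsY : S Y
    · simp only [lab, hsX, hsY, if_true, ofLex_toLex] at hlab ⊢
      rw [hlab]
      simp only [firstPositive_congr hX hXY (by omega)]
    · simp only [lab, hsX, hsY, if_true, if_false, ofLex_toLex] at hlab
      have h1 := hbig Y hsY
      have h2 := hb X hX hsX
      omega
    · simp only [lab, hsX, hsY, if_true, if_false, ofLex_toLex] at hlab
      have h1 := hbig X hsX
      have h2 := hb Y hY hsY
      omega
    -- The common maximum is positive, so by `hne` it is attained on one side only, and monotonicity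
    -- forces the same side for `X` and `Y`.
    · simp only [lab, hsX, hsY, if_false, ofLex_toLex] at hlab ⊢
      rw [hlab]
      congr 2
      have h1 := hbig X hsX
      have h2 := hbig Y hsY
      have h3 := hne X
      have h4 := hne Y
      have h5 := hmono _ _ hXY
      have h6 := hmono _ _ (hSLE _ _ hXY)
      simp only [decide_eq_decide]
      omega
  · intro X hX
    have hXpos := altLength_pos hX
    by_cases hs : S X
    · simp only [lab, hs, if_true, ofLex_toLex]
      have := hb X hX hs
      omega
    · simp only [lab, hs, if_false, ofLex_toLex]
      have h1 := hbig X hs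
      have h2 := hmax X
      omega

end Alternation

/-! ### The altermatic bounds on the chromatic number. -/

section ChromaticLowerBound

variable {γ : Type*}

/-- The largest colour, counted from `1`, of a hyperedge contained in `A`, and `0` if there is
none. -/
noncomputable def topColour {H : Hypergraph γ} {C : ℕ} (c : H.edgeSet → Fin C) (A : Set γ) : ℕ :=
  sSup {k : ℕ | ∃ e : H.edgeSet, (e : Set γ) ⊆ A ∧ (c e : ℕ) + 1 = k}

theorem bddAbove_topColour {H : Hypergraph γ} {C : ℕ} (c : H.edgeSet → Fin C) (A : Set γ) :
    BddAbove {k : ℕ | ∃ e : H.edgeSet, (e : Set γ) ⊆ A ∧ (c e : ℕ) + 1 = k} := by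
  refine ⟨C, ?_⟩
  rintro k ⟨e, -, rfl⟩
  exact (c e).2

theorem le_topColour {H : Hypergraph γ} {C : ℕ} (c : H.edgeSet → Fin C) {A : Set γ}
    {e : H.edgeSet} (he : (e : Set γ) ⊆ A) : (c e : ℕ) + 1 ≤ topColour c A :=
  le_csSup (bddAbove_topColour c A) ⟨e, he, rfl⟩

theorem exists_of_topColour_ne_zero {H : Hypergraph γ} {C : ℕ} {c : H.edgeSet → Fin C}
    {A : Set γ} (h : topColour c A ≠ 0) :
    ∃ e : H.edgeSet, (e : Set γ) ⊆ A ∧ (c e : ℕ) + 1 = topColour c A := by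
  refine Nat.sSup_mem (s := {k : ℕ | ∃ e : H.edgeSet, (e : Set γ) ⊆ A ∧ (c e : ℕ) + 1 = k}) ?_
    (bddAbove_topColour c A)
  by_contra hemp
  rw [Set.not_nonempty_iff_eq_empty] at hemp
  exact h (by rw [topColour, hemp, csSup_empty]; rfl)

theorem topColour_ne_zero_iff {H : Hypergraph γ} {C : ℕ} {c : H.edgeSet → Fin C} {A : Set γ} :
    topColour c A ≠ 0 ↔ ContainsHyperedge H A := by
  constructor
  · intro h
    obtain ⟨e, he, -⟩ := exists_of_topColour_ne_zero h
    exact ⟨e, e.2, he⟩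
  · rintro ⟨e, he, heA⟩
    have := le_topColour c (e := ⟨e, he⟩) heA
    omega

theorem topColour_mono {H : Hypergraph γ} {C : ℕ} (c : H.edgeSet → Fin C) {A B : Set γ}
    (h : A ⊆ B) : topColour c A ≤ topColour c B := by
  by_cases h0 : topColour c A = 0
  · omega
  · obtain ⟨e, he, hc⟩ := exists_of_topColour_ne_zero h0
    rw [← hc]
    exact le_topColour c (he.trans h)

theorem topColour_le {H : Hypergraph γ} {C : ℕ} (c : H.edgeSet → Fin C) (A : Set γ) :
    topColour c A ≤ C := by
  by_cases h0 : topColour c A = 0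
  · omega
  · obtain ⟨e, he, hc⟩ := exists_of_topColour_ne_zero h0
    rw [← hc]
    exact (c e).2

/-- Hyperedges realising a common positive value would be disjoint, and distinct because nonempty,
hence adjacent with the same colour. -/
theorem topColour_disjoint {H : Hypergraph γ} (hH : IsFiniteHypergraph H) {C : ℕ}
    (c : (kneserGraph H).Coloring (Fin C)) {A B : Set γ} (hAB : Disjoint A B)
    (h : topColour (H := H) c A = topColour (H := H) c B) : topColour (H := H) c A = 0 := by
  by_contra h0
  obtain ⟨e, he, hc⟩ := exists_of_topColour_ne_zero h0
  obtain ⟨e', he', hc'⟩ := exists_of_topColour_ne_zero (h ▸ h0)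
  have hd : Disjoint (e : Set γ) (e' : Set γ) := hAB.mono he he'
  have hne : e ≠ e' := by
    rintro rfl
    exact (hH.2 e e.2).ne_empty (disjoint_self.1 hd)
  refine c.valid (show (kneserGraph H).Adj e e' from ⟨hne, hd⟩) (Fin.ext ?_)
  omega

theorem signPart_mono {V : Set γ} {n : ℕ} (σ : Fin n ≃ V) {X Y : Fin n → SignType}
    (h : SignLE X Y) {s : SignType} (hs : s ≠ 0) : signPart σ X s ⊆ signPart σ Y s := by
  rintro v ⟨j, hj, rfl⟩
  exact ⟨j, by rw [h j (hj ▸ hs), hj], rfl⟩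

theorem signPart_neg {V : Set γ} {n : ℕ} (σ : Fin n ≃ V) (X : Fin n → SignType) (s : SignType) :
    signPart σ (-X) s = signPart σ X (-s) := by
  ext v
  simp only [signPart, Pi.neg_apply, neg_eq_iff_eq_neg]

theorem disjoint_signPart {V : Set γ} {n : ℕ} (σ : Fin n ≃ V) (X : Fin n → SignType) :
    Disjoint (signPart σ X 1) (signPart σ X (-1)) := by
  rw [Set.disjoint_left]
  rintro v ⟨j, hj, rfl⟩ ⟨k, hk, hkj⟩
  have := σ.injective (Subtype.ext hkj)
  subst this
  rw [hj] at hk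
  exact absurd hk (by decide)

theorem altLength_le_altOrd (H : Hypergraph γ) (σ : VertexOrdering H)
    {X : Fin H.vertexSet.ncard → SignType} (hX : X ≠ 0)
    (h1 : ¬ ContainsHyperedge H (signPart σ X 1))
    (h2 : ¬ ContainsHyperedge H (signPart σ X (-1))) : altLength X ≤ altOrd H σ := by
  refine le_csSup ⟨H.vertexSet.ncard, ?_⟩ ⟨X, hX, rfl, h1, h2⟩
  rintro k ⟨X, -, rfl, -⟩
  exact altLength_le X

theorem altLength_le_saltOrd (H : Hypergraph γ) (σ : VertexOrdering H)
    {X : Fin H.vertexSet.ncard → SignType} (hX : X ≠ 0)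
    (h : ¬ (ContainsHyperedge H (signPart σ X 1) ∧ ContainsHyperedge H (signPart σ X (-1)))) :
    altLength X ≤ saltOrd H σ := by
  refine le_csSup ⟨H.vertexSet.ncard, ?_⟩ ⟨X, hX, rfl, h⟩
  rintro k ⟨X, -, rfl, -⟩
  exact altLength_le X

theorem ncard_le_altOrd_add {H : Hypergraph γ} (hH : IsFiniteHypergraph H)
    (σ : VertexOrdering H) {C : ℕ} (hC : (kneserGraph H).Colorable C) :
    H.vertexSet.ncard ≤ altOrd H σ + C := by
  obtain ⟨c⟩ := hC
  have := add_le_of_colour (n := H.vertexSet.ncard) (b := altOrd H σ) (C := C) (t := 1)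
    (fun X => topColour (H := H) c (signPart σ X 1))
    (fun X Y h => topColour_mono _ (signPart_mono σ h (by decide)))
    (fun X => topColour_le _ _)
    (fun X h => by
      rw [signPart_neg] at h
      exact topColour_disjoint hH c (disjoint_signPart σ X) h)
    (fun X => ¬ ContainsHyperedge H (signPart σ X 1) ∧ ¬ ContainsHyperedge H (signPart σ X (-1)))
    (fun X => by simp only [signPart_neg, neg_neg]; exact and_comm)
    (fun X hX h => altLength_le_altOrd H σ hX h.1 h.2) le_rfl (by omega) ?_
  · omega
  · intro X hX
    rw [signPart_neg]
    simp only [← topColour_ne_zero_iff (c := (c : H.edgeSet → Fin C))] at hX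
    omega

/-- The extra 1 comes from taking `t = 2`. A hyperedge is needed: without one, `C = 0` is allowed
and the inequality fails, as `saltOrd` never exceeds the number of vertices. -/
theorem ncard_add_one_le_saltOrd_add {H : Hypergraph γ} (hH : IsFiniteHypergraph H)
    (hne : H.edgeSet.Nonempty) (σ : VertexOrdering H) {C : ℕ}
    (hC : (kneserGraph H).Colorable C) : H.vertexSet.ncard + 1 ≤ saltOrd H σ + C := by
  obtain ⟨c⟩ := hC
  obtain ⟨e, he⟩ := hne
  have hCpos : 0 < C := (c ⟨e, he⟩).pos
  have := add_le_of_colour (n := H.vertexSet.ncard) (b := saltOrd H σ) (C := C) (t := 2)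
    (fun X => topColour (H := H) c (signPart σ X 1))
    (fun X Y h => topColour_mono _ (signPart_mono σ h (by decide)))
    (fun X => topColour_le _ _)
    (fun X h => by
      rw [signPart_neg] at h
      exact topColour_disjoint hH c (disjoint_signPart σ X) h)
    (fun X => ¬ (ContainsHyperedge H (signPart σ X 1) ∧ ContainsHyperedge H (signPart σ X (-1))))
    (fun X => by simp only [signPart_neg, neg_neg, and_comm])
    (fun X hX h => altLength_le_saltOrd H σ hX h) (by omega) (by omega) ?_
  · omega
  · intro X hX
    -- Both parts contain hyperedges and their top colours differ, so the larger one is at least 2.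
    have hd := topColour_disjoint hH c (disjoint_signPart σ X)
    rw [signPart_neg]
    simp only [← topColour_ne_zero_iff (c := (c : H.edgeSet → Fin C)), not_not] at hX
    omega

theorem nonempty_vertexOrdering {H : Hypergraph γ} (hH : IsFiniteHypergraph H) :
    Nonempty (VertexOrdering H) := by
  have := hH.1.fintype
  refine ⟨(Fintype.equivFinOfCardEq ?_).symm⟩
  rw [Set.ncard_eq_toFinset_card', Set.toFinset_card]

theorem altermaticNumber_le_chromaticNumber {W : Type*} (Γ : SimpleGraph W) :
    altermaticNumber Γ ≤ Γ.chromaticNumber := by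
  refine iSup_le fun H => iSup_le fun hH => iSup_le fun ⟨φ⟩ => ?_
  refine le_iInf₂ fun C hC => ?_
  have := nonempty_vertexOrdering hH
  obtain ⟨σ, hσ⟩ := ciInf_mem (altOrd H)
  have h := ncard_le_altOrd_add hH σ (hC.of_hom φ.toHom)
  rw [hσ] at h
  rw [Nat.cast_le]
  exact Nat.sub_le_iff_le_add'.2 h

theorem strongAltermaticNumber_le_chromaticNumber {W : Type*} [Nonempty W] (Γ : SimpleGraph W) :
    strongAltermaticNumber Γ ≤ Γ.chromaticNumber := by
  refine iSup_le fun H => iSup_le fun hH => iSup_le fun ⟨φ⟩ => ?_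
  refine le_iInf₂ fun C hC => ?_
  have := nonempty_vertexOrdering hH
  obtain ⟨σ, hσ⟩ := ciInf_mem (saltOrd H)
  have hne : H.edgeSet.Nonempty := ⟨_, (φ.symm (Classical.arbitrary W)).2⟩
  have h := ncard_add_one_le_saltOrd_add hH hne σ (hC.of_hom φ.toHom)
  rw [hσ] at h
  rw [Nat.cast_le]
  exact Nat.sub_le_iff_le_add'.2 h

end ChromaticLowerBound

/-! ### Counting an alternating subsequence block by block. -/

section BlockCounting

/-- In an alternating sign sequence, a term `s` occurs on an interval at most once more than the
other sign. -/
theorem card_filter_sign_le {m : ℕ} {t : Fin m → SignType}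
    (ht : ∀ i k : Fin m, (i : ℕ) + 1 = k → t i ≠ t k) (s : SignType) {B : Finset (Fin m)}
    (hB : ∀ a ∈ B, ∀ c ∈ B, ∀ b, a ≤ b → b ≤ c → b ∈ B) :
    (B.filter fun i => t i = s).card ≤ (B.filter fun i => t i ≠ s).card + 1 := by
  rcases (B.filter fun i => t i = s).eq_empty_or_nonempty with h0 | hne
  · simp [h0]
  set M := (B.filter fun i => t i = s).max' hne with hM
  have hMmem := Finset.max'_mem _ hne
  rw [← hM] at hMmem
  rw [← Finset.card_erase_add_one hMmem]
  refine Nat.add_le_add_right ?_ 1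
  have hlt : ∀ i ∈ (B.filter fun i => t i = s).erase M, i < M := fun i hi =>
    lt_of_le_of_ne (Finset.le_max' _ _ (Finset.mem_of_mem_erase hi)) (Finset.ne_of_mem_erase hi)
  -- Each term `s` other than the last goes to its successor, which is not `s` and still lies in the
  -- interval; the `else` value is never taken.
  refine Finset.card_le_card_of_injOn
    (fun i => if h : (i : ℕ) + 1 < m then ⟨i + 1, h⟩ else i) ?_ ?_
  · intro i hi
    have hiM := hlt i hi
    have hib := Finset.mem_filter.1 (Finset.mem_of_mem_erase hi)
    have h : (i : ℕ) + 1 < m := lt_of_le_of_lt hiM M.2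
    simp only [h, dif_pos, Finset.coe_filter, Set.mem_ofPred_eq]
    refine ⟨hB i hib.1 M (Finset.mem_filter.1 hMmem).1 _ ?_ ?_, ?_⟩
    · exact Fin.le_def.2 (Nat.le_succ _)
    · exact Fin.le_def.2 hiM
    · intro h'
      exact ht i ⟨i + 1, h⟩ rfl (by rw [h', hib.2])
  · intro i hi k hk hik
    have h : (i : ℕ) + 1 < m := lt_of_le_of_lt (hlt i hi) M.2
    have h' : (k : ℕ) + 1 < m := lt_of_le_of_lt (hlt k hk) M.2
    simp only [h, h', dif_pos, Fin.mk.injEq] at hik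
    exact Fin.ext (by omega)

variable {n m : ℕ} {ι : Type*} [DecidableEq ι] {κ : Fin n → ι} {X : Fin n → SignType}
  {j : Fin m → Fin n}

/-- The positions whose block contains a term `s` of `X`. -/
def blockClosure (κ : Fin n → ι) (X : Fin n → SignType) (s : SignType) : Finset (Fin n) :=
  Finset.univ.filter fun p => ∃ q, κ q = κ p ∧ X q = s

theorem card_block_le (hj : IsAlternating X j) (c : ι) :
    (Finset.univ.filter fun i => κ (j i) = c).card ≤
      (Finset.univ.filter fun p => κ p = c).card :=
  Finset.card_le_card_of_injOn j (fun i hi => by simpa using hi) hj.1.injective.injOn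

theorem card_block_filter_sign_le (hκ : ∀ a b c, a ≤ b → b ≤ c → κ a = κ c → κ b = κ a)
    (hj : IsAlternating X j) (s : SignType) (c : ι) :
    ((Finset.univ.filter fun i => κ (j i) = c).filter fun i => X (j i) = s).card ≤
      ((Finset.univ.filter fun i => κ (j i) = c).filter fun i => X (j i) ≠ s).card + 1 := by
  refine card_filter_sign_le hj.2.2 s ?_
  intro a ha b hb x hax hxb
  simp only [Finset.mem_filter, Finset.mem_univ, true_and] at *
  rw [← ha]
  exact hκ _ _ _ (hj.1.monotone hax) (hj.1.monotone hxb) (ha.trans hb.symm)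

theorem card_blockClosure_filter {c : ι} {s : SignType} (h : ∃ q, κ q = c ∧ X q = s) :
    ((blockClosure κ X s).filter fun p => κ p = c).card =
      (Finset.univ.filter fun p => κ p = c).card := by
  congr 1
  ext p
  simp only [blockClosure, Finset.mem_filter, Finset.mem_univ, true_and, and_iff_right_iff_imp]
  rintro rfl
  exact h

/-- In a block of size `d ≥ 2` with `k` chosen positions: if `X` takes both signs there, the block
counts twice and `2 * k ≤ 2 * d`; if only one, alternation gives `k ≤ 1` and `2 * k ≤ d`; if none,
`k = 0`. -/
theorem two_mul_le_card_blockClosure_add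
    (hκ : ∀ a b c, a ≤ b → b ≤ c → κ a = κ c → κ b = κ a)
    (h2 : ∀ p, 2 ≤ (Finset.univ.filter fun q => κ q = κ p).card) (hj : IsAlternating X j) :
    2 * m ≤ (blockClosure κ X 1).card + (blockClosure κ X (-1)).card := by
  have hm : m = (Finset.univ : Finset (Fin m)).card := by simp
  have hmem : ∀ p, κ p ∈ Finset.univ.image κ := fun p => by simp
  rw [hm, Finset.card_eq_sum_card_fiberwise (f := fun i => κ (j i)) (t := Finset.univ.image κ)
      fun i _ => hmem (j i),
    Finset.card_eq_sum_card_fiberwise (s := blockClosure κ X 1) (f := κ)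
      (t := Finset.univ.image κ) fun p _ => hmem p,
    Finset.card_eq_sum_card_fiberwise (s := blockClosure κ X (-1)) (f := κ)
      (t := Finset.univ.image κ) fun p _ => hmem p,
    Finset.mul_sum, ← Finset.sum_add_distrib]
  refine Finset.sum_le_sum fun c hc => ?_
  obtain ⟨p, -, rfl⟩ := Finset.mem_image.1 hc
  have hcard := card_block_le (κ := κ) hj (κ p)
  have hp := h2 p
  have hone : ∀ s, (∀ i, κ (j i) = κ p → X (j i) = s) →
      (Finset.univ.filter fun i => κ (j i) = κ p).card ≤ 1 := by
    intro s hs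
    have := card_block_filter_sign_le hκ hj s (κ p)
    have hB : ∀ i ∈ Finset.univ.filter fun i => κ (j i) = κ p, X (j i) = s := fun i hi =>
      hs i (Finset.mem_filter.1 hi).2
    rwa [Finset.filter_true_of_mem hB, Finset.filter_false_of_mem fun i hi => not_not.2 (hB i hi),
      Finset.card_empty] at this
  have hsign : ∀ a : SignType, a ≠ 0 → a = 1 ∨ a = -1 := by decide
  by_cases hpos : ∃ q, κ q = κ p ∧ X q = 1 <;> by_cases hneg : ∃ q, κ q = κ p ∧ X q = -1
  · rw [card_blockClosure_filter hpos, card_blockClosure_filter hneg]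
    omega
  · have := hone 1 fun i hi => (hsign _ (hj.2.1 i)).resolve_right fun h => hneg ⟨_, hi, h⟩
    rw [card_blockClosure_filter hpos]
    omega
  · have := hone (-1) fun i hi => (hsign _ (hj.2.1 i)).resolve_left fun h => hpos ⟨_, hi, h⟩
    rw [card_blockClosure_filter hneg]
    omega
  · rw [Finset.filter_false_of_mem]
    · simp
    · intro i _ hi
      rcases hsign _ (hj.2.1 i) with h | h
      · exact hpos ⟨_, hi, h⟩
      · exact hneg ⟨_, hi, h⟩

/-- If a block of size `d` carries `a` chosen terms `s`, alternation gives `2 * a ≤ d + 1`, and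
evenness of `d` improves this to `2 * a ≤ d`. Globally, the terms `-s` outnumber the terms `s` by at
most one, which is the final `+ 1`. -/
theorem le_card_blockClosure_add_one
    (hκ : ∀ a b c, a ≤ b → b ≤ c → κ a = κ c → κ b = κ a)
    (h2 : ∀ p, Even (Finset.univ.filter fun q => κ q = κ p).card) (hj : IsAlternating X j)
    (s : SignType) (hs : s ≠ 0) : m ≤ (blockClosure κ X s).card + 1 := by
  have hopp : ∀ a s : SignType, a ≠ 0 → s ≠ 0 → (a ≠ s ↔ a = -s) := by decide
  have hopp' : ∀ a s : SignType, a ≠ 0 → s ≠ 0 → (a ≠ -s ↔ a = s) := by decide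
  have hle := card_filter_sign_le hj.2.2 (-s) (B := Finset.univ) (by simp)
  have hadd := Finset.card_filter_add_card_filter_not (s := (Finset.univ : Finset (Fin m)))
    (fun i => X (j i) = -s)
  simp only [Finset.card_univ, Fintype.card_fin] at hadd
  have hS : (Finset.univ.filter fun i => X (j i) ≠ -s) =
      Finset.univ.filter fun i => X (j i) = s := by
    ext i
    simp [hopp' _ s (hj.2.1 i) hs]
  have hmain : 2 * (Finset.univ.filter fun i => X (j i) = s).card ≤ (blockClosure κ X s).card := by
    have hmem : ∀ p, κ p ∈ Finset.univ.image κ := fun p => by simp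
    rw [Finset.card_eq_sum_card_fiberwise (f := fun i => κ (j i)) (t := Finset.univ.image κ)
        fun i _ => hmem (j i),
      Finset.card_eq_sum_card_fiberwise (s := blockClosure κ X s) (f := κ)
        (t := Finset.univ.image κ) fun p _ => hmem p, Finset.mul_sum]
    refine Finset.sum_le_sum fun c hc => ?_
    obtain ⟨p, -, rfl⟩ := Finset.mem_image.1 hc
    rw [Finset.filter_comm]
    rcases ((Finset.univ.filter fun i => κ (j i) = κ p).filter
      fun i => X (j i) = s).eq_empty_or_nonempty with h0 | ⟨i, hi⟩
    · simp [h0]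
    · simp only [Finset.mem_filter, Finset.mem_univ, true_and] at hi
      rw [card_blockClosure_filter ⟨_, hi⟩]
      have h1 := card_block_filter_sign_le hκ hj s (κ p)
      have h3 := card_block_le (κ := κ) hj (κ p)
      have h4 := Finset.card_filter_add_card_filter_not
        (s := Finset.univ.filter fun i => κ (j i) = κ p) (fun i => X (j i) = s)
      obtain ⟨r, hr⟩ := h2 p
      simp only [ne_eq] at h1
      omega
  simp only [ne_eq] at hS hle
  rw [hS] at hle hadd
  omega

end BlockCounting

/-! ### Copies, parallel edges and the Turán number. -/

section Turan

open Graph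

variable {α β : Type*} {G : Graph α β} {𝓕 : Set (Graph α β)}

/-- The ordered pairs of ends of the edge `e`. Two edges are parallel when these agree. -/
def linkSet (G : Graph α β) (e : β) : Set (α × α) := {p | G.IsLink e p.1 p.2}

theorem linkSet_eq_iff {e f : β} :
    linkSet G e = linkSet G f ↔ ∀ x y, G.IsLink e x y ↔ G.IsLink f x y := by
  simp [linkSet, Set.ext_iff]

/-- The edges parallel to a member of `A`. -/
def parallelClosure (G : Graph α β) (A : Set β) : Set β :=
  {f | f ∈ G.edgeSet ∧ ∃ e ∈ A, linkSet G e = linkSet G f}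

theorem le_of_edgeSet_subset {L H : Graph α β} (hL : L ≤ G) (hH : H.IsSpanningSubgraph G)
    (h : L.edgeSet ⊆ H.edgeSet) : L ≤ H where
  vertexSet_mono := by
    rw [hH.vertexSet_eq]
    exact hL.vertexSet_mono
  isLink_mono e x y he := (hH.le.isLink_iff (h he.edge_mem)).2 (he.mono hL)

/-- A copy in the closure can be moved into `A` by replacing each edge with a parallel one from `A`.
Simplicity makes the replacement injective, since a copy has no two parallel edges. -/
theorem not_containsHyperedge_parallelClosure (h𝓕 : ∀ K ∈ 𝓕, K.Simple) {A : Set β}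
    (hA : ¬ ContainsHyperedge (copyHypergraph G 𝓕) A) :
    ¬ ContainsHyperedge (copyHypergraph G 𝓕) (parallelClosure G A) := by
  rintro ⟨_, ⟨L, hLG, ⟨K, hK, φ, ψ, hiso⟩, rfl⟩, hsub⟩
  refine hA ?_
  have : ∀ f, ∃ e, f ∈ L.edgeSet → e ∈ A ∧ linkSet G e = linkSet G f := by
    intro f
    by_cases hf : f ∈ L.edgeSet
    · obtain ⟨e, he⟩ := (hsub hf).2
      exact ⟨e, fun _ => he⟩
    · exact ⟨f, fun h => absurd h hf⟩
  choose ρ hρ using this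
  have hlink : ∀ f x y, L.IsLink f x y → G.IsLink (ρ f) x y := fun f x y h =>
    (linkSet_eq_iff.1 (hρ f h.edge_mem).2 x y).2 (h.mono hLG)
  have hinj : ∀ f ∈ L.edgeSet, ∀ f' ∈ L.edgeSet, ρ f = ρ f' → f = f' := by
    intro f hf f' hf' h
    obtain ⟨x, y, hxy⟩ := exists_isLink_of_mem_edgeSet hf
    have hxy' : L.IsLink f' x y := by
      rw [hLG.isLink_iff hf', ← linkSet_eq_iff.1 (hρ f' hf').2, ← h]
      exact hlink _ _ _ hxy
    have := h𝓕 K hK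
    have h1 := (hiso ⟨f, hf⟩ ⟨x, hxy.left_mem⟩ ⟨y, hxy.right_mem⟩).1 hxy
    have h2 := (hiso ⟨f', hf'⟩ ⟨x, hxy.left_mem⟩ ⟨y, hxy.right_mem⟩).1 hxy'
    exact congrArg Subtype.val (ψ.injective (Subtype.ext (h1.eq h2)))
  -- The moved copy: the vertices of `L`, with every edge `f` replaced by `ρ f`.
  let L' : Graph α β :=
    { vertexSet := L.vertexSet
      IsLink := fun e x y => ∃ f, ρ f = e ∧ L.IsLink f x y
      isLink_symm := fun e _ => ⟨fun x y ⟨f, hf, h⟩ => ⟨f, hf, h.symm⟩⟩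
      eq_or_eq_of_isLink_of_isLink := by
        rintro e x y v w ⟨f, rfl, h⟩ ⟨f', hf', h'⟩
        refine (hlink _ _ _ h).left_eq_or_eq ?_
        rw [← hf']
        exact hlink _ _ _ h'
      left_mem_of_isLink := by
        rintro e x y ⟨f, -, h⟩
        exact h.left_mem }
  let τ : L.edgeSet → L'.edgeSet := fun f =>
    ⟨ρ f, by
      obtain ⟨x, y, hxy⟩ := exists_isLink_of_mem_edgeSet f.2
      exact ⟨x, y, f, rfl, hxy⟩⟩
  have hτ : Function.Bijective τ := by
    constructor
    · intro f f' h
      exact Subtype.ext (hinj f f.2 f' f'.2 (congrArg Subtype.val h))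
    · rintro ⟨e, x, y, f, rfl, hf⟩
      exact ⟨⟨f, hf.edge_mem⟩, rfl⟩
  refine ⟨L'.edgeSet, ⟨L', ⟨hLG.vertexSet_mono, ?_⟩,
    ⟨K, hK, φ, (Equiv.ofBijective τ hτ).symm.trans ψ, ?_⟩, rfl⟩, ?_⟩
  · rintro e x y ⟨f, rfl, h⟩
    exact hlink _ _ _ h
  · intro e x y
    obtain ⟨f, rfl⟩ := hτ.2 e
    have hsymm : (Equiv.ofBijective τ hτ).symm (τ f) = f :=
      (Equiv.ofBijective τ hτ).symm_apply_apply f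
    rw [Equiv.trans_apply, hsymm, ← hiso]
    constructor
    · rintro ⟨f', hf', h⟩
      rwa [hinj f' h.edge_mem f f.2 hf'] at h
    · exact fun h => ⟨f, rfl, h⟩
  · rintro e ⟨x, y, f, rfl, hf⟩
    exact (hρ f hf.edge_mem).1

theorem bddAbove_ex (hE : G.edgeSet.Finite) (𝓕 : Set (Graph α β)) :
    BddAbove {k : ℕ | ∃ H : Graph α β,
      H.IsSpanningSubgraph G ∧ IsFree H 𝓕 ∧ H.edgeSet.ncard = k} := by
  refine ⟨G.edgeSet.ncard, ?_⟩
  rintro k ⟨H, hH, -, rfl⟩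
  exact Set.ncard_le_ncard hH.le.edgeSet_mono hE

theorem ncard_le_ex (hE : G.edgeSet.Finite) {A : Set β} (hAE : A ⊆ G.edgeSet)
    (hA : ¬ ContainsHyperedge (copyHypergraph G 𝓕) A) : A.ncard ≤ ex G 𝓕 := by
  have hedge : (G.restrict A).edgeSet = A := Set.inter_eq_right.2 hAE
  refine le_csSup (bddAbove_ex hE 𝓕) ⟨G.restrict A, ⟨restrict_le, rfl⟩, ?_, by rw [hedge]⟩
  intro L hL K hK hLK
  refine hA ⟨L.edgeSet, ⟨L, hL.trans restrict_le, ⟨K, hK, hLK⟩, rfl⟩, ?_⟩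
  exact hL.edgeSet_mono.trans hedge.subset

theorem IsIsomorphic.nonempty_edgeSet {L K : Graph α β} (h : IsIsomorphic L K)
    (hK : K.edgeSet.Nonempty) : L.edgeSet.Nonempty := by
  obtain ⟨-, ψ, -⟩ := h
  obtain ⟨e, he⟩ := hK
  exact ⟨_, (ψ.symm ⟨e, he⟩).2⟩

theorem exists_ncard_eq_ex (hE : G.edgeSet.Finite) (h𝓕 : ∀ K ∈ 𝓕, K.edgeSet.Nonempty) :
    ∃ H : Graph α β, H.IsSpanningSubgraph G ∧ IsFree H 𝓕 ∧ H.edgeSet.ncard = ex G 𝓕 := by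
  -- The edgeless spanning subgraph shows that the set is nonempty; it is free because every member
  -- of `𝓕` has an edge.
  refine Nat.sSup_mem (s := {k : ℕ | ∃ H : Graph α β,
    H.IsSpanningSubgraph G ∧ IsFree H 𝓕 ∧ H.edgeSet.ncard = k})
    ⟨0, noEdge G.vertexSet β, ⟨by simp, rfl⟩, ?_, by simp⟩ (bddAbove_ex hE 𝓕)
  intro L hL K hK hLK
  obtain ⟨e, he⟩ := hLK.nonempty_edgeSet (h𝓕 K hK)
  simpa using hL.edgeSet_mono he

theorem colorable_KG (hE : G.edgeSet.Finite) (h𝓕 : ∀ K ∈ 𝓕, K.edgeSet.Nonempty) :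
    (KG G 𝓕).Colorable (G.edgeSet.ncard - ex G 𝓕) := by
  obtain ⟨H, hH, hfree, hcard⟩ := exists_ncard_eq_ex hE h𝓕
  have hmeet : ∀ A : (copyHypergraph G 𝓕).edgeSet, ∃ e ∈ (A : Set β), e ∈ G.edgeSet \ H.edgeSet := by
    rintro ⟨_, L, hL, ⟨K, hK, hLK⟩, rfl⟩
    by_contra! h
    refine hfree L (le_of_edgeSet_subset hL hH fun e he => ?_) K hK hLK
    by_contra heH
    exact h e he ⟨hL.edgeSet_mono he, heH⟩
  choose c hc hc' using hmeet
  have := (hE.sdiff (t := H.edgeSet)).fintype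
  have hcol : (KG G 𝓕).Colorable (Fintype.card ↥(G.edgeSet \ H.edgeSet)) :=
    (SimpleGraph.Coloring.mk (fun A => (⟨c A, hc' A⟩ : ↥(G.edgeSet \ H.edgeSet))) (by
      intro A B hAB h
      have : c A = c B := congrArg Subtype.val h
      exact Set.disjoint_left.1 hAB.2 (hc A) (this ▸ hc B))).colorable
  rwa [← hcard, ← Set.ncard_sdiff hH.le.edgeSet_mono (hE.subset hH.le.edgeSet_mono),
    Set.ncard_eq_toFinset_card', Set.toFinset_card]

end Turan

/-! ### Orderings by parallel classes and the resulting lower bounds. -/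

section Assembly

variable {α β : Type*} {G : Graph α β} {𝓕 : Set (Graph α β)}

/-- Sort by any linear order on the values: the fibres of a monotone map are intervals. -/
theorem exists_perm_blocks {ι : Type*} {n : ℕ} (f : Fin n → ι) :
    ∃ π : Equiv.Perm (Fin n), ∀ a b c, a ≤ b → b ≤ c → f (π a) = f (π c) → f (π b) = f (π a) := by
  classical
  let _ : LinearOrder ι := linearOrderOfSTO WellOrderingRel
  have hmono : Monotone (f ∘ Tuple.sort f) := Tuple.monotone_sort f
  exact ⟨Tuple.sort f, fun a b c hab hbc h =>
    le_antisymm ((hmono hbc).trans_eq h.symm) (hmono hab)⟩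

/-- The edges of a finite multigraph can be listed with parallel edges next to each other. -/
theorem exists_ordering_linkSet (G : Graph α β) {n : ℕ} (e : Fin n ≃ G.edgeSet) :
    ∃ τ : Fin n ≃ G.edgeSet, ∀ a b c, a ≤ b → b ≤ c →
      linkSet G (τ a) = linkSet G (τ c) → linkSet G (τ b) = linkSet G (τ a) := by
  obtain ⟨π, hπ⟩ := exists_perm_blocks fun p => linkSet G (e p)
  exact ⟨π.trans e, hπ⟩

variable {n : ℕ} (τ : Fin n ≃ G.edgeSet)

theorem card_filter_linkSet [DecidableEq (Set (α × α))] (p : Fin n) :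
    (Finset.univ.filter fun q => linkSet G (τ q) = linkSet G (τ p)).card =
      edgeMultiplicity G (τ p) := by
  classical
  have hinj : Function.Injective fun q => (τ q : β) := Subtype.val_injective.comp τ.injective
  rw [edgeMultiplicity, ← Finset.card_image_of_injective _ hinj, ← Set.ncard_coe_finset]
  congr 1
  ext f
  simp only [Finset.coe_image, Finset.coe_filter, Finset.mem_univ, true_and, Set.mem_image,
    Set.mem_ofPred_eq, linkSet_eq_iff]
  constructor
  · rintro ⟨q, hq, rfl⟩
    exact ⟨(τ q).2, hq⟩
  · rintro ⟨hf, h⟩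
    exact ⟨τ.symm ⟨f, hf⟩, by simpa using h, by simp⟩

theorem card_blockClosure_le_ex [DecidableEq (Set (α × α))] (hE : G.edgeSet.Finite)
    (h𝓕 : ∀ K ∈ 𝓕, K.Simple) {X : Fin n → SignType} {s : SignType}
    (h : ¬ ContainsHyperedge (copyHypergraph G 𝓕) (signPart τ X s)) :
    (blockClosure (fun q => linkSet G (τ q)) X s).card ≤ ex G 𝓕 := by
  classical
  have hinj : Function.Injective fun q => (τ q : β) := Subtype.val_injective.comp τ.injective
  refine le_of_eq_of_le ?_ (ncard_le_ex hE (fun e he => he.1)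
    (not_containsHyperedge_parallelClosure h𝓕 h))
  rw [← Finset.card_image_of_injective _ hinj, ← Set.ncard_coe_finset]
  congr 1
  ext f
  simp only [Finset.coe_image, blockClosure, Finset.coe_filter, Finset.mem_univ, true_and,
    Set.mem_image, Set.mem_ofPred_eq, parallelClosure, signPart]
  constructor
  · rintro ⟨p, ⟨q, hq, hX⟩, rfl⟩
    exact ⟨(τ p).2, τ q, ⟨q, hX, rfl⟩, hq⟩
  · rintro ⟨hf, _, ⟨q, hX, rfl⟩, h⟩
    exact ⟨τ.symm ⟨f, hf⟩, ⟨q, by simpa using h, hX⟩, by simp⟩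

variable {τ}

theorem altLength_le_ex (hE : G.edgeSet.Finite) (h𝓕 : ∀ K ∈ 𝓕, K.Simple)
    (hτ : ∀ a b c, a ≤ b → b ≤ c →
      linkSet G (τ a) = linkSet G (τ c) → linkSet G (τ b) = linkSet G (τ a))
    (hmult : ∀ e ∈ G.edgeSet, 2 ≤ edgeMultiplicity G e) {X : Fin n → SignType}
    (h1 : ¬ ContainsHyperedge (copyHypergraph G 𝓕) (signPart τ X 1))
    (h2 : ¬ ContainsHyperedge (copyHypergraph G 𝓕) (signPart τ X (-1))) :
    altLength X ≤ ex G 𝓕 := by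
  classical
  obtain ⟨j, hj⟩ := exists_isAlternating X
  have h := two_mul_le_card_blockClosure_add (κ := fun q => linkSet G (τ q)) hτ
    (fun p => (card_filter_linkSet τ p).symm ▸ hmult _ (τ p).2) hj
  have h3 := card_blockClosure_le_ex τ hE h𝓕 h1
  have h4 := card_blockClosure_le_ex τ hE h𝓕 h2
  omega

theorem altLength_le_ex_add_one (hE : G.edgeSet.Finite) (h𝓕 : ∀ K ∈ 𝓕, K.Simple)
    (hτ : ∀ a b c, a ≤ b → b ≤ c →
      linkSet G (τ a) = linkSet G (τ c) → linkSet G (τ b) = linkSet G (τ a))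
    (hmult : ∀ e ∈ G.edgeSet, Even (edgeMultiplicity G e)) {X : Fin n → SignType}
    {s : SignType} (hs : s ≠ 0)
    (h : ¬ ContainsHyperedge (copyHypergraph G 𝓕) (signPart τ X s)) :
    altLength X ≤ ex G 𝓕 + 1 := by
  classical
  obtain ⟨j, hj⟩ := exists_isAlternating X
  have h1 := le_card_blockClosure_add_one (κ := fun q => linkSet G (τ q)) hτ
    (fun p => (card_filter_linkSet τ p).symm ▸ hmult _ (τ p).2) hj s hs
  have h2 := card_blockClosure_le_ex τ hE h𝓕 h
  omega

/-! ### Renaming vertices by natural numbers, as the altermatic numbers require. -/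

section Transport

variable {γ : Type*} (H : Hypergraph γ) {V : Set ℕ} (g : V ≃ H.vertexSet)

/-- The hypergraph `H` with its vertices renamed along a bijection onto a set of natural numbers. -/
def renamedHypergraph : Hypergraph ℕ where
  vertexSet := V
  edgeSet := (fun A : Set γ => Subtype.val '' (g ⁻¹' (Subtype.val ⁻¹' A))) '' H.edgeSet
  subset_vertexSet_of_mem_edgeSet' := by
    rintro _ ⟨A, -, rfl⟩ _ ⟨v, -, rfl⟩
    exact v.2

theorem disjoint_renamed_iff {A B : Set γ} (hA : A ⊆ H.vertexSet) :
    Disjoint (Subtype.val '' (g ⁻¹' (Subtype.val ⁻¹' A)) : Set ℕ)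
      (Subtype.val '' (g ⁻¹' (Subtype.val ⁻¹' B))) ↔ Disjoint A B := by
  rw [Set.disjoint_image_iff Subtype.val_injective, Set.disjoint_left, Set.disjoint_left]
  constructor
  · intro h x hx hxB
    exact h (a := g.symm ⟨x, hA hx⟩) (by simpa using hx) (by simpa using hxB)
  · intro h v hv hvB
    exact h hv hvB

theorem nonempty_kneserGraph_renamed_iso :
    Nonempty (kneserGraph (renamedHypergraph H g) ≃g kneserGraph H) := by
  let f : H.edgeSet → (renamedHypergraph H g).edgeSet := fun A => ⟨_, A, A.2, rfl⟩
  have hsub : ∀ A : H.edgeSet, (A : Set γ) ⊆ H.vertexSet := fun A =>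
    H.subset_vertexSet_of_mem_edgeSet A.2
  have hf : Function.Bijective f := by
    constructor
    · intro A B h
      have h1 := Subtype.val_injective.image_injective (congrArg Subtype.val h)
      have h2 := g.surjective.preimage_injective h1
      refine Subtype.ext ?_
      rwa [Subtype.preimage_coe_eq_preimage_coe_iff, Set.inter_eq_right.2 (hsub A),
        Set.inter_eq_right.2 (hsub B)] at h2
    · rintro ⟨_, A, hA, rfl⟩
      exact ⟨⟨A, hA⟩, rfl⟩
  refine ⟨RelIso.symm ⟨Equiv.ofBijective f hf, ?_⟩⟩
  intro A B
  exact and_congr (not_congr hf.1.eq_iff) (disjoint_renamed_iff H g (hsub A))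

theorem isFiniteHypergraph_renamed (hV : V.Finite) (hne : ∀ A ∈ H.edgeSet, A.Nonempty) :
    IsFiniteHypergraph (renamedHypergraph H g) := by
  refine ⟨hV, ?_⟩
  rintro _ ⟨A, hA, rfl⟩
  obtain ⟨x, hx⟩ := hne A hA
  exact ⟨_, g.symm ⟨x, H.subset_vertexSet_of_mem_edgeSet hA hx⟩, by simpa using hx, rfl⟩

/-- Used contrapositively: sign parts free of hyperedges after renaming were free of copies before,
so bounds on `altLength` carry over. -/
theorem containsHyperedge_renamed {n : ℕ} {τ : Fin n ≃ H.vertexSet} {X : Fin n → SignType}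
    {s : SignType} (h : ContainsHyperedge H (signPart τ X s)) :
    ContainsHyperedge (renamedHypergraph H g) (signPart (τ.trans g.symm) X s) := by
  obtain ⟨A, hA, hsub⟩ := h
  refine ⟨_, ⟨A, hA, rfl⟩, ?_⟩
  rintro _ ⟨v, hv, rfl⟩
  obtain ⟨p, hp, hpv⟩ := hsub hv
  refine ⟨p, hp, congrArg Subtype.val ?_⟩
  rw [Equiv.trans_apply, Equiv.symm_apply_eq]
  exact Subtype.ext hpv

end Transport

theorem copyHypergraph_nonempty_of_mem (h𝓕 : ∀ K ∈ 𝓕, K.edgeSet.Nonempty) :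
    ∀ A ∈ (copyHypergraph G 𝓕).edgeSet, A.Nonempty := by
  rintro _ ⟨L, -, ⟨K, hK, hLK⟩, rfl⟩
  exact hLK.nonempty_edgeSet (h𝓕 K hK)

/-- A copy of `copyHypergraph G 𝓕` on natural numbers, with an ordering of its vertices that lists
parallel edges next to each other. -/
theorem exists_renamed_copyHypergraph (hE : G.edgeSet.Finite)
    (h𝓕 : ∀ K ∈ 𝓕, K.edgeSet.Nonempty) :
    ∃ H : Hypergraph ℕ, IsFiniteHypergraph H ∧ Nonempty (kneserGraph H ≃g KG G 𝓕) ∧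
      H.vertexSet.ncard = G.edgeSet.ncard ∧
      ∃ (σ : VertexOrdering H) (τ : Fin H.vertexSet.ncard ≃ G.edgeSet),
        (∀ a b c, a ≤ b → b ≤ c →
          linkSet G (τ a) = linkSet G (τ c) → linkSet G (τ b) = linkSet G (τ a)) ∧
        ∀ X s, ContainsHyperedge (copyHypergraph G 𝓕) (signPart τ X s) →
          ContainsHyperedge H (signPart σ X s) := by
  have := hE.fintype
  have hcard : Fintype.card G.edgeSet = G.edgeSet.ncard := by
    rw [Set.ncard_eq_toFinset_card', Set.toFinset_card]
  let e : Fin G.edgeSet.ncard ≃ G.edgeSet := (Fintype.equivFinOfCardEq hcard).symm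
  let g : Set.range (Fin.val : Fin G.edgeSet.ncard → ℕ) ≃ (copyHypergraph G 𝓕).vertexSet :=
    (Equiv.ofInjective _ Fin.val_injective).symm.trans e
  have hn : (renamedHypergraph _ g).vertexSet.ncard = G.edgeSet.ncard := by
    change (Set.range (Fin.val : Fin G.edgeSet.ncard → ℕ)).ncard = _
    rw [← Set.image_univ, Set.ncard_image_of_injective _ Fin.val_injective, Set.ncard_univ,
      Nat.card_eq_fintype_card, Fintype.card_fin]
  obtain ⟨τ, hτ⟩ := exists_ordering_linkSet G ((finCongr hn).trans e)
  exact ⟨renamedHypergraph _ g,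
    isFiniteHypergraph_renamed _ g (Set.finite_range _) (copyHypergraph_nonempty_of_mem h𝓕),
    nonempty_kneserGraph_renamed_iso _ g, hn, τ.trans g.symm, τ, hτ,
    fun X s h => containsHyperedge_renamed (copyHypergraph G 𝓕) g h⟩

theorem sub_ex_le_altermaticNumber (hE : G.edgeSet.Finite)
    (hmult : ∀ e ∈ G.edgeSet, 2 ≤ edgeMultiplicity G e)
    (h𝓕 : ∀ K ∈ 𝓕, K.Simple ∧ K.edgeSet.Nonempty) :
    ((G.edgeSet.ncard - ex G 𝓕 : ℕ) : ℕ∞) ≤ altermaticNumber (KG G 𝓕) := by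
  obtain ⟨H, hH, hiso, hn, σ, τ, hτ, hcont⟩ :=
    exists_renamed_copyHypergraph hE fun K hK => (h𝓕 K hK).2
  refine le_trans ?_ (le_iSup_of_le H (le_iSup_of_le hH (le_iSup_of_le hiso le_rfl)))
  have hle : alt H ≤ ex G 𝓕 := by
    refine (ciInf_le (OrderBot.bddBelow _) σ).trans (csSup_le' ?_)
    rintro _ ⟨X, -, rfl, h1, h2⟩
    exact altLength_le_ex hE (fun K hK => (h𝓕 K hK).1) hτ hmult (fun h => h1 (hcont _ _ h))
      fun h => h2 (hcont _ _ h)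
  rw [Nat.cast_le, hn]
  exact Nat.sub_le_sub_left hle _

theorem sub_ex_le_strongAltermaticNumber (hE : G.edgeSet.Finite)
    (hmult : ∀ e ∈ G.edgeSet, Even (edgeMultiplicity G e))
    (h𝓕 : ∀ K ∈ 𝓕, K.Simple ∧ K.edgeSet.Nonempty) :
    ((G.edgeSet.ncard - ex G 𝓕 : ℕ) : ℕ∞) ≤ strongAltermaticNumber (KG G 𝓕) := by
  obtain ⟨H, hH, hiso, hn, σ, τ, hτ, hcont⟩ :=
    exists_renamed_copyHypergraph hE fun K hK => (h𝓕 K hK).2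
  refine le_trans ?_ (le_iSup_of_le H (le_iSup_of_le hH (le_iSup_of_le hiso le_rfl)))
  have hle : salt H ≤ ex G 𝓕 + 1 := by
    refine (ciInf_le (OrderBot.bddBelow _) σ).trans (csSup_le' ?_)
    rintro _ ⟨X, -, rfl, h⟩
    rcases not_and_or.1 h with h | h
    · exact altLength_le_ex_add_one hE (fun K hK => (h𝓕 K hK).1) hτ hmult (s := 1) (by decide)
        fun h' => h (hcont _ _ h')
    · exact altLength_le_ex_add_one hE (fun K hK => (h𝓕 K hK).1) hτ hmult (s := -1) (by decide)
        fun h' => h (hcont _ _ h')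
  rw [Nat.cast_le, hn]
  omega

end Assembly

end KneserMultigraph

theorem mainTheorem1 {α β : Type*} (G : Graph α β)
    (hV : G.vertexSet.Finite) (hE : G.edgeSet.Finite)
    (hmult : ∀ e ∈ G.edgeSet, 2 ≤ KneserMultigraph.edgeMultiplicity G e)
    (𝓕 : Set (Graph α β)) (hne : 𝓕.Nonempty)
    (h𝓕 : ∀ K ∈ 𝓕, K ≤ G ∧ K.Simple ∧ K.edgeSet.Nonempty) :
    ((KneserMultigraph.KG G 𝓕).chromaticNumber
        = KneserMultigraph.altermaticNumber (KneserMultigraph.KG G 𝓕) ∧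
      KneserMultigraph.altermaticNumber (KneserMultigraph.KG G 𝓕)
        = ((G.edgeSet.ncard - KneserMultigraph.ex G 𝓕 : ℕ) : ℕ∞)) ∧
    ((∀ e ∈ G.edgeSet, Even (KneserMultigraph.edgeMultiplicity G e)) →
      (KneserMultigraph.KG G 𝓕).chromaticNumber
        = KneserMultigraph.strongAltermaticNumber (KneserMultigraph.KG G 𝓕)) := by
  have hupper := (KneserMultigraph.colorable_KG hE
    fun K hK => (h𝓕 K hK).2.2).chromaticNumber_le
  have hlower := KneserMultigraph.sub_ex_le_altermaticNumber hE hmult fun K hK => (h𝓕 K hK).2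
  have hzeta := KneserMultigraph.altermaticNumber_le_chromaticNumber (KneserMultigraph.KG G 𝓕)
  refine ⟨⟨le_antisymm (hupper.trans hlower) hzeta, le_antisymm (hzeta.trans hupper) hlower⟩,
    fun heven => le_antisymm
      (hupper.trans (KneserMultigraph.sub_ex_le_strongAltermaticNumber hE heven
        fun K hK => (h𝓕 K hK).2)) ?_⟩
  -- The strong bound needs a vertex of the Kneser graph; a member of `𝓕` is a subgraph of `G` and a
  -- copy of itself.
  obtain ⟨K, hK⟩ := hne
  have : Nonempty (KneserMultigraph.copyHypergraph G 𝓕).edgeSet :=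
    ⟨⟨K.edgeSet, K, (h𝓕 K hK).1, ⟨K, hK, Equiv.refl _, Equiv.refl _, fun _ _ _ => Iff.rfl⟩, rfl⟩⟩
  exact KneserMultigraph.strongAltermaticNumber_le_chromaticNumber _
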